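/- **Setting.** Let $p\in(0,1)$, $\Omega=\{0,1\}^{\mathbb Z}$ with the product $\sigma$-algebra, and let $\mu_p$ be the Bernoulli($p$) product measure on $\Omega$. Let $T:\Omega\to\Omega$, $(T\omega)_i=\omega_i\bigl(1-(1-\omega_{i-1})(1-\omega_{i+1})\bigr)$, be the map that removes isolated occupied sites, let $\Omega'=T(\Omega)$ with the trace $\sigma$-algebra $\mathscr F'$, and for $\Delta\subset\mathbb Z$ let $\mathscr F'_\Delta\subset\mathscr F'$ be the $\sigma$-algebra generated by the spins in $\Delta$. The thinned Bernoulli field is $\mu'_p=\mu_p\circ T^{-1}$ on $(\Omega',\mathscr F')$. For $\Lambda\subset\mathbb Z$ let $\partial_+\Lambda$ be the set of sites outside $\Lambda$ with a nearest neighbour in $\Lambda$, and $\overline\Lambda=\Lambda\cup\partial_+\Lambda$. **Specifications and Gibbs measures.** A specification on $\Omega'$ is a family $\gamma=(\gamma_\Lambda)_{\Lambda\Subset\mathbb Z}$, indexed by the finite subsets of $\mathbb Z$, of probability kernels from $(\Omega',\mathscr F'_{\Lambda^c})$ to $(\Omega',\mathscr F')$ that are proper ($\gamma_\Lambda(A|\omega')=1_A(\omega')$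 for $A\in\mathscr F'_{\Lambda^c}$) and consistent ($\gamma_\Delta\gamma_\Lambda=\gamma_\Delta$ for $\Lambda\subset\Delta\Subset\mathbb Z$). A Gibbs measure for $\gamma$ is a probability measure $\mu$ on $(\Omega',\mathscr F')$ with $\mu(A|\mathscr F'_{\Lambda^c})=\gamma_\Lambda(A|\cdot)$ $\mu$-a.s. for all $\Lambda\Subset\mathbb Z$ and $A\in\mathscr F'$. **The kernels $\gamma'_{p,\Lambda}$.** For $\omega'\in\Omega'$ let $\Theta=\{x:\omega'_x=1\}$, let $\mathscr U(\omega')$ be the set of connected components of $\mathbb Z\setminus\overline\Theta$, and let $\mathscr U_\Lambda(\omega')$ be the set of those $U\in\mathscr U(\omega')$ with $\operatorname{dist}(\overline\Lambda,U)\le 1$. Put $$Q=\begin{pmatrix}1-p&\sqrt{p(1-p)}\\ \sqrt{p(1-p)}&0\end{pmatrix},\qquad \lambda=\tfrac12\Bigl(1-p+\sqrt{(1-p)(3p+1)}\Bigr),\qquad D=\frac{(1-p)(\lambda+2p)}{\lambda^3},$$ $V_-=[\min\overline\Lambda,\infty)\cap\mathbb Z$, $V_+=(-\infty,\max\overline\Lambda]\cap\mathbb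 Z$, and $$Z(U)=\frac1{1-p}\cdot\begin{cases}Q^{|U|+1}(0,0)&\text{if }|U|<\infty,\\ \lambda^{|U\cap V_-|}&\text{if }\inf U=-\infty,\ \sup U<\infty,\\ \lambda^{|U\cap V_+|}&\text{if }\inf U>-\infty,\ \sup U=\infty,\\ D\,\lambda^{|V_-\cap V_+|}&\text{if }U=\mathbb Z.\end{cases}$$ Given the boundary condition $\omega'\in\Omega'$, the probability measure $\gamma'_{p,\Lambda}(\cdot|\omega')$ is concentrated on the finitely many $\eta'\in\Omega'$ that agree with $\omega'$ off $\Lambda$, and gives to each of them a mass proportional to $$p^{|\Theta(\eta')\cap\overline\Lambda|}\,(1-p)^{|\partial_+\Theta(\eta')\cap\overline\Lambda|}\prod_{U\in\mathscr U_\Lambda(\eta')}Z(U).$$ **Proposition.** For every $p\in(0,1)$, $\gamma'_p=(\gamma'_{p,\Lambda})_{\Lambda\Subset\mathbb Z}$ is a specification on $\Omega'$, and $\mu'_p$ is its unique Gibbs measure. Moreover $\gamma'_p$ satisfies the following finite-energy condition with $C=2^{-16}p^8$: for each cylinder event $A\in\mathscr F'$ (that is, $A\in\mathscr F'_\Delta$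 for some finite $\Delta$) there is $\Lambda\Subset\mathbb Z$ such that $$\gamma'_{p,\Lambda}(A|\zeta')\ \ge\ C\,\gamma'_{p,\Lambda}(A|\eta')\qquad\text{for all }\zeta',\eta'\in\Omega'.$$ -/

import Mathlib

namespace ThinnedBernoulli

open MeasureTheory
open scoped ENNReal ProbabilityTheory

/-- Spin configurations on the line; `ω i = 1` means that the site `i` is occupied. -/
abbrev Config : Type := ℤ → Fin 2

/-- The projection to non-isolation, `(Tω)_i = ω_i (1 - ∏_{j ∼ i} (1 - ω_j))`. The arithmetic of
`Fin 2` (modulo 2) agrees here with that of the integers, as all factors lie in `{0, 1}`. -/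
def thin (ω : Config) : Config :=
  fun i => ω i * (1 - (1 - ω (i - 1)) * (1 - ω (i + 1)))

/-- The space `Ω' = T(Ω)` of non-isolated configurations. As a subtype it carries the trace of the
product σ-algebra. -/
abbrev NonIso : Type := ↥(Set.range thin)

/-- The projection `T`, as a map onto `Ω'`. -/
def toNonIso (ω : Config) : NonIso := ⟨thin ω, ω, rfl⟩

/-- The Bernoulli product measure `μ_p` on `{0,1}^ℤ`. -/
noncomputable def bernoulliField (p : unitInterval) : Measure Config :=
  Measure.infinitePi fun _ : ℤ => ProbabilityTheory.bernoulliMeasure (1 : Fin 2) 0 p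

/-- The thinned Bernoulli field `μ'_p = μ_p ∘ T⁻¹`, a measure on `Ω'`. -/
noncomputable def thinnedField (p : unitInterval) : Measure NonIso :=
  (bernoulliField p).map toNonIso

/-- The σ-algebra `𝓕'_Δ` on `Ω'` of the events that depend only on the spins in `Δ`. -/
abbrev eventsIn (Δ : Set ℤ) : MeasurableSpace NonIso :=
  (cylinderEvents (X := fun _ : ℤ => Fin 2) Δ).comap Subtype.val

/-- Cylinder events in `Ω'`: they depend on the spins in some finite set only. -/
def IsCylinderEvent (A : Set NonIso) : Prop :=
  ∃ Δ : Finset ℤ, MeasurableSet[eventsIn (Δ : Set ℤ)] A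

section Specifications

/-- Specifications on `Ω'`: consistent families of proper probability kernels `γ_Λ` from
`(Ω', 𝓕'_{Λᶜ})` to `(Ω', 𝓕')`, indexed by the finite subsets `Λ` of `ℤ`.
Here `γ Λ ω A` is `γ_Λ(A | ω)`. -/
structure IsSpecification (γ : Finset ℤ → NonIso → Measure NonIso) : Prop where
  isProbabilityMeasure : ∀ Λ ω, IsProbabilityMeasure (γ Λ ω)
  measurable : ∀ (Λ : Finset ℤ) (A : Set NonIso), MeasurableSet A →
    Measurable[eventsIn (Λ : Set ℤ)ᶜ] fun ω => γ Λ ω A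
  proper : ∀ (Λ : Finset ℤ) (A : Set NonIso), MeasurableSet[eventsIn (Λ : Set ℤ)ᶜ] A →
    ∀ ω, γ Λ ω A = A.indicator 1 ω
  consistent : ∀ Λ Δ : Finset ℤ, Λ ⊆ Δ → ∀ A : Set NonIso, MeasurableSet A →
    ∀ ω, ∫⁻ ξ, γ Λ ξ A ∂(γ Δ ω) = γ Δ ω A

/-- The set `𝒢(γ)` of Gibbs measures: the probability measures `μ` on `Ω'` that satisfy the DLR
equations `μ(A | 𝓕'_{Λᶜ}) = γ_Λ(A | ·)` `μ`-almost surely. -/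
def gibbsMeasures (γ : Finset ℤ → NonIso → Measure NonIso) : Set (Measure NonIso) :=
  {μ | IsProbabilityMeasure μ ∧
    ∀ (Λ : Finset ℤ) (A : Set NonIso), MeasurableSet A →
      μ⟦A | eventsIn (Λ : Set ℤ)ᶜ⟧ =ᵐ[μ] fun ω => (γ Λ ω).real A}

end Specifications

section Geometry

/-- The outer boundary `∂₊Λ` in the nearest-neighbour graph `ℤ`. -/
def outerBoundary (Λ : Set ℤ) : Set ℤ := {j | j ∉ Λ ∧ ∃ i ∈ Λ, |i - j| = 1}

/-- The closure `Λ ∪ ∂₊Λ`. -/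
def latticeClosure (Λ : Set ℤ) : Set ℤ := Λ ∪ outerBoundary Λ

/-- The set `Θ` of occupied sites. -/
def occupied (ω : NonIso) : Set ℤ := {x | ω.1 x = 1}

/-- The unfixed area, the complement of the closure of `Θ`. -/
def unfixedArea (ω : NonIso) : Set ℤ := (latticeClosure (occupied ω))ᶜ

/-- The set `𝒰` of connected components of the unfixed area: in `ℤ` the component of `x` consists
of the `y` such that all sites between `x` and `y` are in the unfixed area. -/
def unfixedComponents (ω : NonIso) : Set (Set ℤ) :=
  {U | ∃ x ∈ unfixedArea ω, U = Set.ordConnectedComponent (unfixedArea ω) x}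

/-- The set `𝒰_Λ` of the components at distance at most `1` from the closure of `Λ`. -/
def unfixedComponentsNear (Λ : Set ℤ) (ω : NonIso) : Set (Set ℤ) :=
  {U | U ∈ unfixedComponents ω ∧ ∃ x ∈ latticeClosure Λ, ∃ y ∈ U, |x - y| ≤ 1}

/-- `V₋ = [min Λ̄, ∞)`, where `Λ̄` is the closure of `Λ`. -/
def rightOfMin (Λ : Set ℤ) : Set ℤ := {x | ∃ y ∈ latticeClosure Λ, y ≤ x}

/-- `V₊ = (-∞, max Λ̄]`, where `Λ̄` is the closure of `Λ`. -/
def leftOfMax (Λ : Set ℤ) : Set ℤ := {x | ∃ y ∈ latticeClosure Λ, x ≤ y}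

end Geometry

section Kernels

/-- The transfer matrix `Q` of the Bernoulli field constrained on isolation. -/
noncomputable def transferMatrix (p : ℝ) : Matrix (Fin 2) (Fin 2) ℝ :=
  !![1 - p, √(p * (1 - p)); √(p * (1 - p)), 0]

/-- The Perron-Frobenius eigenvalue of the transfer matrix. -/
noncomputable def lamPF (p : ℝ) : ℝ := (1 - p + √((1 - p) * (3 * p + 1))) / 2

/-- The constant `D(p)`. -/
noncomputable def constD (p : ℝ) : ℝ := (1 - p) * (lamPF p + 2 * p) / lamPF p ^ 3

open Classical in
/-- The partition function `Z(U)` of a component `U` of the unfixed area, for the observation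
window `Λ`. -/
noncomputable def componentWeight (p : ℝ) (Λ U : Set ℤ) : ℝ :=
  (1 - p)⁻¹ *
    if U.Finite then (transferMatrix p ^ (U.ncard + 1)) 0 0
    else if BddAbove U then lamPF p ^ (U ∩ rightOfMin Λ).ncard
    else if BddBelow U then lamPF p ^ (U ∩ leftOfMax Λ).ncard
    else constD p * lamPF p ^ (rightOfMin Λ ∩ leftOfMax Λ).ncard

/-- The unnormalised weight
`p ^ |Θ ∩ Λ̄| (1 - p) ^ |∂₊Θ ∩ Λ̄| ∏_{U ∈ 𝒰_Λ} Z(U)` of a configuration. The set `𝒰_Λ` is finite,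
so that `∏ᶠ` is an actual finite product. -/
noncomputable def weight (p : ℝ) (Λ : Set ℤ) (ω : NonIso) : ℝ :=
  p ^ (occupied ω ∩ latticeClosure Λ).ncard *
    (1 - p) ^ (outerBoundary (occupied ω) ∩ latticeClosure Λ).ncard *
    ∏ᶠ U ∈ unfixedComponentsNear Λ ω, componentWeight p Λ U

/-- The non-isolated configurations that agree with `ω` off `Λ`. -/
def sameOff (Λ : Finset ℤ) (ω : NonIso) : Set NonIso := {η | ∀ i ∉ Λ, η.1 i = ω.1 i}

theorem sameOff_finite (Λ : Finset ℤ) (ω : NonIso) : (sameOff Λ ω).Finite := by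
  refine Set.Finite.of_finite_image (f := fun η : NonIso => fun i : Λ => η.1 i)
    (Set.toFinite _) ?_
  intro η hη ξ hξ h
  apply Subtype.ext
  funext i
  by_cases hi : i ∈ Λ
  · exact congrFun h ⟨i, hi⟩
  · rw [hη i hi, hξ i hi]

/-- The partition function `Z_Λ(ω_{Λᶜ})`, which normalises the weights of the configurations that
agree with `ω` off `Λ`. -/
noncomputable def partitionFunction (p : ℝ) (Λ : Finset ℤ) (ω : NonIso) : ℝ :=
  ∑ η ∈ (sameOff_finite Λ ω).toFinset, weight p Λ η

/-- The kernels `γ'_{p,Λ}(· | ω)`: given the boundary condition `ω_{Λᶜ}`, a non-isolated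
configuration `η` that agrees with `ω` off `Λ` has probability `weight η / Z_Λ(ω_{Λᶜ})`. -/
noncomputable def thinnedSpec (p : ℝ) (Λ : Finset ℤ) (ω : NonIso) : Measure NonIso :=
  ∑ η ∈ (sameOff_finite Λ ω).toFinset,
    ENNReal.ofReal (weight p Λ η / partitionFunction p Λ ω) • Measure.dirac η

end Kernels

end ThinnedBernoulli

/-! A configuration whose thinned image is $\Theta$ consists of $\Theta$ and of isolated points off
the closure of $\Theta$. Summing out these points yields $p^{|\Theta|}(1-p)^{|\partial_+\Theta|}$
times a product, over the components of the unfixed area, of partition functions of sparse sets (no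
two neighbours). On an interval these satisfy the two-step recursion given by the characteristic
polynomial of $Q$, so a finite component of length $n$ contributes $Q^{n+1}(0,0)/(1-p)$. An infinite
component has to be cut by a finite window. If the cut site gets the activity $\lambda+p-1$ instead
of $p$, the sum over $n$ sites is exactly $\lambda^n$; with a cut at both ends it is
$(1-p)D\lambda^n$. Enlarging the window thus costs only powers of $\lambda$ that do not depend on
the spins in $\Lambda$.

Hence, in a window whose ends lie in an occupied bond or in an empty half-line, `weight` is
proportional, among configurations agreeing off $\Lambda$, to `windowWeight`, the mass of the
$T$-preimage under a finite product weight (`IsWindow.weight_mul_windowWeight`). So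
$\gamma'_\Lambda$ is the $T$-image of a finite product measure conditioned to have the prescribed
image off $\Lambda$ (`IsWindow.thinnedSpec_preimage`). As `windowWeight` does not involve $\Lambda$,
consistency follows (`weight_mul_weight`).

The decisive point is that $(T\omega)_x$ reads only $x-1,x,x+1$. The image off $[a-2,b+2]$ depends
on sites outside $[a-1,b+1]$, the image in $[a,b]$ on sites inside. By the product structure,
$\gamma'_{[a-2,b+2]}(A|\omega')=\mu'_p(A)$ for all $\omega'$ and all $A\in\mathscr F'_{[a,b]}$
(`thinnedSpec_Icc`). This gives uniqueness at once, and finite energy even with constant $1$.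

For the Gibbs property it remains to see that $\mu'_p\gamma'_\Lambda=\mu'_p$. When occupied bonds
surround $\Lambda$ inside $[-k,k]$, the kernel is a local function of the boundary condition, so
$\mu'_p$ may be replaced by some $\gamma'_\Delta$ and consistency applies. Such bonds exist almost
surely, so $k\to\infty$ gives "$\le$" on cylinder events, and passing to complements gives equality.
-/

namespace ThinnedBernoulli

open Finset

/-! ### Partition functions of sparse sets and the fibres of the thinning map. -/

section SparseSums

theorem sum_powerset_union {R : Type*} [AddCommMonoid R] {S T : Finset ℤ} (h : Disjoint S T)
    (f : Finset ℤ → R) :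
    ∑ A ∈ (S ∪ T).powerset, f A = ∑ B ∈ S.powerset, ∑ C ∈ T.powerset, f (B ∪ C) := by
  rw [← Finset.sum_product']
  rw [Finset.disjoint_left] at h
  refine Finset.sum_nbij' (fun A => (A ∩ S, A ∩ T)) (fun x => x.1 ∪ x.2) ?_ ?_ ?_ ?_ ?_
  · intro A _
    simp
  · intro x hx
    simp only [mem_product, mem_powerset] at hx ⊢
    exact union_subset_union hx.1 hx.2
  · intro A hA
    simp only [mem_powerset] at hA
    rw [← inter_union_distrib_left]
    exact inter_eq_left.2 hA
  · rintro ⟨B, C⟩ hx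
    simp only [mem_product, mem_powerset] at hx
    obtain ⟨hB, hC⟩ := hx
    ext x
    · have := @hB x
      have := @hC x
      have := @h x
      simp only [mem_inter, mem_union]
      tauto
    · have := @hB x
      have := @hC x
      have := @h x
      simp only [mem_inter, mem_union]
      tauto
  · intro A hA
    simp only [mem_powerset] at hA
    rw [← inter_union_distrib_left, inter_eq_left.2 hA]

/-- The weight of the configuration with occupied set `A` in the window `S`, for site-dependent
activities `a` and the weight `q` of empty sites. -/
def siteWeight (a : ℤ → ℝ) (q : ℝ) (S A : Finset ℤ) : ℝ := (∏ x ∈ A, a x) * q ^ (S \ A).card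

theorem siteWeight_union {a : ℤ → ℝ} {q : ℝ} {S T B C : Finset ℤ} (h : Disjoint S T)
    (hB : B ⊆ S) (hC : C ⊆ T) :
    siteWeight a q (S ∪ T) (B ∪ C) = siteWeight a q S B * siteWeight a q T C := by
  unfold siteWeight
  have h1 : (S ∪ T) \ (B ∪ C) = (S \ B) ∪ (T \ C) := by
    rw [Finset.disjoint_left] at h
    ext x
    have := @hB x
    have := @hC x
    have := @h x
    simp only [mem_sdiff, mem_union]
    tauto
  rw [h1, Finset.prod_union (Finset.disjoint_of_subset_left hB
    (Finset.disjoint_of_subset_right hC h)),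
    Finset.card_union_of_disjoint (Finset.disjoint_of_subset_left sdiff_subset
    (Finset.disjoint_of_subset_right sdiff_subset h)), pow_add]
  ring

theorem siteWeight_congr {a b : ℤ → ℝ} {q : ℝ} {S A : Finset ℤ} (hA : A ⊆ S)
    (h : ∀ x ∈ S, a x = b x) : siteWeight a q S A = siteWeight b q S A := by
  unfold siteWeight
  rw [Finset.prod_congr rfl fun x hx => h x (hA hx)]

/-- The partition function of the sparse subsets (without neighbouring sites) of `S`. -/
def sparseSum (a : ℤ → ℝ) (q : ℝ) (S : Finset ℤ) : ℝ :=
  ∑ A ∈ S.powerset with ∀ x ∈ A, x + 1 ∉ A, siteWeight a q S A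

theorem sparseSum_congr {a b : ℤ → ℝ} {q : ℝ} {S : Finset ℤ}
    (h : ∀ x ∈ S, a x = b x) : sparseSum a q S = sparseSum b q S := by
  refine Finset.sum_congr rfl fun A hA => siteWeight_congr ?_ h
  simp only [mem_filter, mem_powerset] at hA
  exact hA.1

theorem sparseSum_empty (a : ℤ → ℝ) (q : ℝ) : sparseSum a q ∅ = 1 := by
  simp [sparseSum, siteWeight, Finset.filter_singleton]

theorem sparseSum_singleton (a : ℤ → ℝ) (q : ℝ) (x : ℤ) : sparseSum a q {x} = q + a x := by
  unfold sparseSum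
  have : (({x} : Finset ℤ).powerset.filter fun A => ∀ y ∈ A, y + 1 ∉ A) = {∅, {x}} := by
    ext A
    simp only [mem_filter, mem_powerset, Finset.subset_singleton_iff, mem_insert, mem_singleton]
    constructor
    · tauto
    · rintro (rfl | rfl) <;> simp
  rw [this, Finset.sum_pair (Finset.singleton_ne_empty x).symm]
  simp [siteWeight]

/-- No bond joins sets at distance greater than 1, so the sparseness constraint splits along with
the product weight. -/
theorem sparseSum_union {a : ℤ → ℝ} {q : ℝ} {S T : Finset ℤ}
    (h : ∀ x ∈ S, ∀ y ∈ T, 1 < |x - y|) :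
    sparseSum a q (S ∪ T) = sparseSum a q S * sparseSum a q T := by
  have hd : Disjoint S T := by
    rw [Finset.disjoint_left]
    intro x hx hx'
    simpa using h x hx x hx'
  unfold sparseSum
  simp only [Finset.sum_filter]
  rw [sum_powerset_union hd, Finset.sum_mul_sum]
  refine Finset.sum_congr rfl fun B hB => Finset.sum_congr rfl fun C hC => ?_
  simp only [mem_powerset] at hB hC
  rw [siteWeight_union hd hB hC]
  have key : (∀ x ∈ B ∪ C, x + 1 ∉ B ∪ C) ↔ (∀ x ∈ B, x + 1 ∉ B) ∧ (∀ x ∈ C, x + 1 ∉ C) := by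
    constructor
    · intro H
      exact ⟨fun x hx hx' => H x (mem_union_left _ hx) (mem_union_left _ hx'),
        fun x hx hx' => H x (mem_union_right _ hx) (mem_union_right _ hx')⟩
    · rintro ⟨H1, H2⟩ x hx hx'
      rw [mem_union] at hx hx'
      rcases hx with hx | hx <;> rcases hx' with hx' | hx'
      · exact H1 x hx hx'
      · simpa using h x (hB hx) _ (hC hx')
      · simpa using h _ (hB hx') x (hC hx)
      · exact H2 x hx hx'
  by_cases h1 : ∀ x ∈ B, x + 1 ∉ B <;> by_cases h2 : ∀ x ∈ C, x + 1 ∉ C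
  · rw [if_pos (key.2 ⟨h1, h2⟩), if_pos h1, if_pos h2]
  · rw [if_neg (fun H => h2 (key.1 H).2), if_neg h2, mul_zero]
  · rw [if_neg (fun H => h1 (key.1 H).1), if_neg h1, zero_mul]
  · rw [if_neg (fun H => h1 (key.1 H).1), if_neg h1, zero_mul]

theorem sparseSum_biUnion {ι : Type*} [DecidableEq ι] {a : ℤ → ℝ} {q : ℝ} (V : Finset ι)
    (f : ι → Finset ℤ)
    (h : ∀ i ∈ V, ∀ j ∈ V, i ≠ j → ∀ x ∈ f i, ∀ y ∈ f j, 1 < |x - y|) :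
    sparseSum a q (V.biUnion f) = ∏ i ∈ V, sparseSum a q (f i) := by
  induction V using Finset.induction_on with
  | empty => simp [sparseSum_empty]
  | insert i V hi ih =>
    rw [Finset.biUnion_insert, Finset.prod_insert hi, sparseSum_union, ih]
    · intro j hj k hk
      exact h j (mem_insert_of_mem hj) k (mem_insert_of_mem hk)
    · intro x hx y hy
      simp only [mem_biUnion] at hy
      obtain ⟨j, hj, hy⟩ := hy
      exact h i (mem_insert_self _ _) j (mem_insert_of_mem hj) (fun e => hi (e ▸ hj)) x hx y hy

/-- Conditioning on the last site of an interval. -/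
theorem sparseSum_Icc_succ (a : ℤ → ℝ) (q : ℝ) (l r : ℤ) (h : l ≤ r + 1) :
    sparseSum a q (Icc l (r + 2)) =
      q * sparseSum a q (Icc l (r + 1)) + a (r + 2) * q * sparseSum a q (Icc l r) := by
  have e1 : Icc l (r + 2) = Icc l (r + 1) ∪ {r + 2} := by ext x; simp; omega
  have hd : Disjoint (Icc l (r + 1)) {r + 2} := by simp
  have e2 : Icc l (r + 1) = Icc l r ∪ {r + 1} := by ext x; simp; omega
  have hd2 : Disjoint (Icc l r) {r + 1} := by simp
  have hp : ∀ y : ℤ, ({y} : Finset ℤ).powerset = {∅, {y}} := by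
    intro y; ext; simp [Finset.subset_singleton_iff]
  unfold sparseSum
  simp only [Finset.sum_filter]
  conv_lhs => rw [e1, sum_powerset_union hd]
  have h3 : ∀ B ∈ (Icc l (r + 1)).powerset,
      (∑ C ∈ ({r + 2} : Finset ℤ).powerset, if ∀ x ∈ B ∪ C, x + 1 ∉ B ∪ C then
        siteWeight a q (Icc l (r + 1) ∪ {r + 2}) (B ∪ C) else 0) =
      q * (if ∀ x ∈ B, x + 1 ∉ B then siteWeight a q (Icc l (r + 1)) B else 0) +
      a (r + 2) * (if (∀ x ∈ B, x + 1 ∉ B) ∧ r + 1 ∉ B then siteWeight a q (Icc l (r + 1)) B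
        else 0) := by
    intro B hB
    simp only [mem_powerset] at hB
    rw [hp, Finset.sum_pair (Finset.singleton_ne_empty _).symm]
    congr 1
    · simp only [union_empty]
      split_ifs
      · have := siteWeight_union (a := a) (q := q) hd hB (empty_subset _)
        rw [union_empty] at this
        rw [this]
        simp [siteWeight]
        ring
      · simp
    -- If the last site is occupied, sparseness forces `r + 1` to be empty.
    · have : (∀ x ∈ B ∪ {r + 2}, x + 1 ∉ B ∪ {r + 2}) ↔
          (∀ x ∈ B, x + 1 ∉ B) ∧ r + 1 ∉ B := by
        have h4 : r + 2 + 1 ∉ B := fun h => by have := hB h; simp at this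
        constructor
        · intro H
          refine ⟨fun x hx hx' => H x (mem_union_left _ hx) (mem_union_left _ hx'), fun hx => ?_⟩
          refine H _ (mem_union_left _ hx) (mem_union_right _ ?_)
          rw [mem_singleton]
          ring
        · rintro ⟨H, H'⟩ x hx hx'
          simp only [mem_union, mem_singleton] at hx hx'
          rcases hx with hx | rfl
          · rcases hx' with hx' | hx'
            · exact H x hx hx'
            · have : x = r + 1 := by linarith
              exact H' (this ▸ hx)
          · rcases hx' with hx' | hx'
            · exact h4 hx'
            · linarith
      simp only [this]
      split_ifs
      · rw [siteWeight_union hd hB (Subset.refl _)]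
        simp [siteWeight]
        ring
      · simp
  rw [Finset.sum_congr rfl h3, Finset.sum_add_distrib, ← Finset.mul_sum, ← Finset.mul_sum]
  congr 1
  rw [mul_assoc]
  congr 1
  -- The empty site `r + 1` contributes a factor `q` and leaves no constraint on `[l, r]`.
  rw [e2, sum_powerset_union hd2, Finset.mul_sum]
  refine Finset.sum_congr rfl fun B hB => ?_
  simp only [mem_powerset] at hB
  have h5 : r + 1 ∉ B := fun h => by have := hB h; simp at this
  rw [hp, Finset.sum_pair (Finset.singleton_ne_empty _).symm]
  simp only [union_empty, mem_union, mem_singleton, or_true, not_true, and_false, if_false,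
    add_zero, h5, not_false_eq_true, and_true]
  split_ifs
  · have := siteWeight_union (a := a) (q := q) hd2 hB (empty_subset _)
    rw [union_empty] at this
    rw [this]
    simp [siteWeight]
    ring
  · simp

/-- The set of the non-isolated points of `A`. -/
def nonIsolated (A : Finset ℤ) : Finset ℤ := A.filter fun x => x - 1 ∈ A ∨ x + 1 ∈ A

theorem mem_nonIsolated {A : Finset ℤ} {x : ℤ} :
    x ∈ nonIsolated A ↔ x ∈ A ∧ (x - 1 ∈ A ∨ x + 1 ∈ A) := by simp [nonIsolated]

/-- The configurations with given non-isolated part `T` arise from `T` by adding sparse sets away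
from the closure of `T`. -/
theorem sum_nonIsolated_eq (a : ℤ → ℝ) (q : ℝ) {I T : Finset ℤ} (hT : nonIsolated T = T)
    (hI : T ⊆ I) :
    ∑ A ∈ I.powerset with nonIsolated A = T, siteWeight a q I A =
      (∏ x ∈ T, a x) * q ^ (I.filter fun x => x ∉ T ∧ (x - 1 ∈ T ∨ x + 1 ∈ T)).card *
        sparseSum a q (I.filter fun x => x ∉ T ∧ x - 1 ∉ T ∧ x + 1 ∉ T) := by
  unfold sparseSum
  rw [Finset.mul_sum]
  have hT' : ∀ x ∈ T, x - 1 ∈ T ∨ x + 1 ∈ T := by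
    intro x hx
    rw [← hT] at hx
    exact (mem_nonIsolated.1 hx).2
  have hu : ∀ A ∈ I.powerset.filter (fun A => nonIsolated A = T), A \ T ∪ T = A := by
    intro A hA
    simp only [mem_filter, mem_powerset] at hA
    refine sdiff_union_of_subset ?_
    rw [← hA.2]
    exact filter_subset _ _
  refine Finset.sum_nbij' (fun A => A \ T) (fun D => D ∪ T) ?_ ?_ hu ?_ ?_
  · intro A hA
    simp only [mem_filter, mem_powerset] at hA
    obtain ⟨hA, h⟩ := hA
    have h' : ∀ x, x ∈ T ↔ x ∈ A ∧ (x - 1 ∈ A ∨ x + 1 ∈ A) := fun x => by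
      rw [← h, mem_nonIsolated]
    simp only [mem_filter, mem_powerset]
    constructor
    · intro x hx
      simp only [mem_sdiff] at hx
      have h1 := h' x
      have h2 := h' (x - 1)
      have h3 := h' (x + 1)
      have := @hA x
      simp only [mem_filter]
      tauto
    · intro x hx hx'
      simp only [mem_sdiff] at hx hx'
      have h1 := h' x
      tauto
  · intro D hD
    simp only [mem_filter, mem_powerset] at hD
    obtain ⟨hD, h⟩ := hD
    have hD' : ∀ x ∈ D, x ∈ I ∧ x ∉ T ∧ x - 1 ∉ T ∧ x + 1 ∉ T := fun x hx => by
      simpa using hD hx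
    simp only [mem_filter, mem_powerset]
    refine ⟨union_subset (fun x hx => (hD' x hx).1) hI, ?_⟩
    ext x
    rw [mem_nonIsolated]
    simp only [mem_union]
    have h1 := hD' x
    have h2 := h x
    have h3 := h (x - 1)
    have h4 := hT' x
    rw [sub_add_cancel] at h3
    tauto
  · intro D hD
    simp only [mem_filter, mem_powerset] at hD
    refine union_sdiff_cancel_right ?_
    rw [Finset.disjoint_left]
    intro x hx
    have := hD.1 hx
    simp only [mem_filter] at this
    tauto
  · intro A hA
    have hA1 := hu A hA
    simp only [mem_filter, mem_powerset] at hA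
    obtain ⟨hA, h⟩ := hA
    have h' : ∀ x, x ∈ T ↔ x ∈ A ∧ (x - 1 ∈ A ∨ x + 1 ∈ A) := fun x => by
      rw [← h, mem_nonIsolated]
    have hd : Disjoint (A \ T) T := sdiff_disjoint
    unfold siteWeight
    -- The empty sites of `A` are the boundary of `T`, which is always empty, and the sites of the
    -- free area left out by the sparse set `A \ T`.
    have h6 : I \ A = (I.filter fun x => x ∉ T ∧ (x - 1 ∈ T ∨ x + 1 ∈ T)) ∪
        ((I.filter fun x => x ∉ T ∧ x - 1 ∉ T ∧ x + 1 ∉ T) \ (A \ T)) := by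
      ext x
      simp only [mem_sdiff, mem_union, mem_filter]
      have h1 := h' x
      have h2 := h' (x - 1)
      have h3 := h' (x + 1)
      rw [sub_add_cancel] at h2
      rw [add_sub_cancel_right] at h3
      by_cases x ∈ A <;> (simp_all; try tauto)
    rw [h6, Finset.card_union_of_disjoint, pow_add]
    · nth_rewrite 1 [← hA1]
      rw [Finset.prod_union hd]
      ring
    · rw [Finset.disjoint_left]
      intro x hx
      simp only [mem_sdiff, mem_filter] at hx ⊢
      tauto

end SparseSums

/-! ### The transfer matrix and exact sparse sums on intervals. -/

section TransferMatrix

variable {p : ℝ}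

theorem transferMatrix_pow_zero_one : (transferMatrix p ^ (0 + 1)) 0 0 = 1 - p := by
  simp [transferMatrix]

/-- Cayley–Hamilton: the trace is `1 - p` and the determinant `-p (1 - p)`. The resulting recursion
is the one of `sparseSum_Icc_succ` for constant activity. -/
theorem transferMatrix_sq (hp : p ∈ Set.Ioo (0 : ℝ) 1) :
    transferMatrix p ^ 2 = (1 - p) • transferMatrix p + (p * (1 - p)) • 1 := by
  have h : √(p * (1 - p)) * √(p * (1 - p)) = p * (1 - p) :=
    Real.mul_self_sqrt (mul_nonneg hp.1.le (by linarith [hp.2]))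
  rw [pow_two]
  ext i j
  fin_cases i <;> fin_cases j <;> (simp [transferMatrix, Matrix.mul_apply, h]; try ring)

theorem transferMatrix_pow_succ_succ (hp : p ∈ Set.Ioo (0 : ℝ) 1) (n : ℕ) :
    (transferMatrix p ^ (n + 2)) 0 0 =
      (1 - p) * (transferMatrix p ^ (n + 1)) 0 0 + p * (1 - p) * (transferMatrix p ^ n) 0 0 := by
  rw [pow_add, transferMatrix_sq hp, mul_add, Matrix.mul_smul, Matrix.mul_smul, mul_one, ← pow_succ]
  simp

theorem transferMatrix_pow_one_one (hp : p ∈ Set.Ioo (0 : ℝ) 1) :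
    (transferMatrix p ^ (1 + 1)) 0 0 = 1 - p := by
  rw [show 1 + 1 = 0 + 2 from rfl, transferMatrix_pow_succ_succ hp, transferMatrix_pow_zero_one]
  simp
  ring

theorem transferMatrix_pow_pos (hp : p ∈ Set.Ioo (0 : ℝ) 1) (n : ℕ) :
    0 < (transferMatrix p ^ (n + 1)) 0 0 := by
  have hq : 0 < 1 - p := by linarith [hp.2]
  have hp0 := hp.1
  induction n using Nat.twoStepInduction with
  | zero => rw [transferMatrix_pow_zero_one]; exact hq
  | one => rw [transferMatrix_pow_one_one hp]; exact hq
  | more n h1 h2 =>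
    rw [show n + 2 + 1 = (n + 1) + 2 from rfl, transferMatrix_pow_succ_succ hp]
    positivity

theorem lamPF_sq (hp : p ∈ Set.Ioo (0 : ℝ) 1) :
    lamPF p ^ 2 = (1 - p) * lamPF p + p * (1 - p) := by
  have h : √((1 - p) * (3 * p + 1)) ^ 2 = (1 - p) * (3 * p + 1) :=
    Real.sq_sqrt (mul_nonneg (by linarith [hp.2]) (by linarith [hp.1]))
  unfold lamPF
  linear_combination h / 4

theorem lamPF_pos (hp : p ∈ Set.Ioo (0 : ℝ) 1) : 0 < lamPF p := by
  unfold lamPF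
  have := Real.sqrt_nonneg ((1 - p) * (3 * p + 1))
  linarith [hp.2]

/-- This makes the modified activity `endActivity` positive. -/
theorem one_sub_lt_lamPF (hp : p ∈ Set.Ioo (0 : ℝ) 1) : 1 - p < lamPF p := by
  have h1 := lamPF_sq hp
  have h2 := lamPF_pos hp
  have h3 : 0 < p * (1 - p) := mul_pos hp.1 (by linarith [hp.2])
  by_contra! h
  nlinarith

theorem constD_pos (hp : p ∈ Set.Ioo (0 : ℝ) 1) : 0 < constD p := by
  have h1 := lamPF_pos hp
  have h2 := hp.1
  have hq : 0 < 1 - p := by linarith [hp.2]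
  unfold constD
  positivity

/-- The form in which `D` is used: `(1 - p) * (2λ + p - 1)` is the sparse sum of two adjacent sites
that both carry the modified activity. -/
theorem constD_mul_lamPF_sq (hp : p ∈ Set.Ioo (0 : ℝ) 1) :
    constD p * lamPF p ^ 2 = 2 * lamPF p + p - 1 := by
  have h1 := lamPF_pos hp
  unfold constD
  field_simp
  linear_combination (-2) * lamPF_sq hp

/-- The activity at the end of a window inside an infinite component of the unfixed area. -/
noncomputable def endActivity (p : ℝ) : ℝ := lamPF p + p - 1

/-- Both sides obey the same two-step recursion and equal `1 - p` for zero and for one site. -/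
theorem sparseSum_Icc_plain (hp : p ∈ Set.Ioo (0 : ℝ) 1) {a : ℤ → ℝ} (l : ℤ) (n : ℕ)
    (ha : ∀ x ∈ Icc l (l + n - 1), a x = p) :
    (1 - p) * sparseSum a (1 - p) (Icc l (l + n - 1)) = (transferMatrix p ^ (n + 1)) 0 0 := by
  rw [sparseSum_congr ha]
  clear ha
  induction n using Nat.twoStepInduction with
  | zero =>
    rw [transferMatrix_pow_zero_one, Icc_eq_empty (by simp), sparseSum_empty, mul_one]
  | one =>
    rw [transferMatrix_pow_one_one hp]
    simp [sparseSum_singleton]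
  | more n h1 h2 =>
    rw [show n + 2 + 1 = (n + 1) + 2 from rfl, transferMatrix_pow_succ_succ hp, ← h1, ← h2,
      show l + ((n + 2 : ℕ) : ℤ) - 1 = (l + n - 1) + 2 by push_cast; ring,
      show l + ((n + 1 : ℕ) : ℤ) - 1 = (l + n - 1) + 1 by push_cast; ring,
      sparseSum_Icc_succ _ _ _ _ (by omega)]
    ring

/-- The activity `λ + p - 1` is chosen so that a single site gives `λ`. Since `λ` is a root of the
characteristic polynomial, the recursion then produces pure powers of `λ`. -/
theorem sparseSum_Icc_left (hp : p ∈ Set.Ioo (0 : ℝ) 1) {a : ℤ → ℝ} (l : ℤ) (n : ℕ)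
    (hl : a l = endActivity p) (ha : ∀ x ∈ Icc l (l + n - 1), x ≠ l → a x = p) :
    sparseSum a (1 - p) (Icc l (l + n - 1)) = lamPF p ^ n := by
  induction n using Nat.twoStepInduction with
  | zero => rw [Icc_eq_empty (by simp), sparseSum_empty, pow_zero]
  | one => simp [sparseSum_singleton, hl, endActivity]
  | more n h1 h2 =>
    have e1 : l + ((n + 2 : ℕ) : ℤ) - 1 = (l + n - 1) + 2 := by push_cast; ring
    have e2 : l + ((n + 1 : ℕ) : ℤ) - 1 = (l + n - 1) + 1 := by push_cast; ring
    rw [e1] at ha ⊢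
    rw [e2] at h2
    rw [sparseSum_Icc_succ _ _ _ _ (by omega),
      h1 fun x hx => ha x (Icc_subset_Icc le_rfl (by omega) hx),
      h2 fun x hx => ha x (Icc_subset_Icc le_rfl (by omega) hx),
      ha _ (by simp; omega) (by omega)]
    linear_combination (-lamPF p ^ n) * lamPF_sq hp

/-- The recursion splits off the right end, hence the modified site; two unmodified sums remain,
given by powers of `Q`. -/
theorem sparseSum_Icc_right (hp : p ∈ Set.Ioo (0 : ℝ) 1) {a : ℤ → ℝ} (l : ℤ) (n : ℕ)
    (hr : a (l + n) = endActivity p) (ha : ∀ x ∈ Icc l (l + n), x ≠ l + n → a x = p) :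
    sparseSum a (1 - p) (Icc l (l + n)) = lamPF p ^ (n + 1) := by
  have hq : 1 - p ≠ 0 := by linarith [hp.2]
  rcases n with _ | n
  · simp at hr
    simp [sparseSum_singleton, hr, endActivity]
  · have e1 : l + ((n + 1 : ℕ) : ℤ) = (l + n - 1) + 2 := by push_cast; ring
    rw [e1] at hr ha ⊢
    rw [sparseSum_Icc_succ _ _ _ _ (by omega), hr]
    have h1 := sparseSum_Icc_plain hp l n (a := a) fun x hx => ha x
      (Icc_subset_Icc le_rfl (by omega) hx) (by simp at hx; omega)
    have h2 := sparseSum_Icc_plain hp l (n + 1) (a := a) fun x hx => ha x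
      (Icc_subset_Icc le_rfl (by push_cast; omega) hx) (by simp at hx; omega)
    rw [show l + ((n + 1 : ℕ) : ℤ) - 1 = (l + n - 1) + 1 by push_cast; ring] at h2
    -- This combination of entries is multiplied by `λ` at each step: the other eigenvalue of `Q`
    -- drops out.
    have h3 : (transferMatrix p ^ (n + 1 + 1)) 0 0 + endActivity p *
        (transferMatrix p ^ (n + 1)) 0 0 = lamPF p ^ (n + 2) := by
      clear * - hp
      induction n with
      | zero =>
        rw [transferMatrix_pow_one_one hp, transferMatrix_pow_zero_one, endActivity]
        linear_combination -lamPF_sq hp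
      | succ n ih =>
        rw [show n + 1 + 1 + 1 = (n + 1) + 2 from rfl, transferMatrix_pow_succ_succ hp]
        rw [show lamPF p ^ (n + 1 + 2) = lamPF p * lamPF p ^ (n + 2) by ring, ← ih]
        unfold endActivity
        linear_combination (-(transferMatrix p ^ (n + 1)) 0 0) * lamPF_sq hp
    rw [show n + 1 + 1 = n + 2 from rfl, ← h3, ← h1, ← h2]
    ring

theorem sparseSum_Icc_both (hp : p ∈ Set.Ioo (0 : ℝ) 1) {a : ℤ → ℝ} (l : ℤ) (n : ℕ)
    (hl : a l = endActivity p) (hr : a (l + n + 1) = endActivity p)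
    (ha : ∀ x ∈ Icc l (l + n + 1), x ≠ l → x ≠ l + n + 1 → a x = p) :
    sparseSum a (1 - p) (Icc l (l + n + 1)) = (1 - p) * constD p * lamPF p ^ (n + 2) := by
  have e1 : l + n + 1 = (l + n - 1) + 2 := by ring
  rw [e1] at hr ha ⊢
  rw [sparseSum_Icc_succ _ _ _ _ (by omega), hr]
  have h1 := sparseSum_Icc_left hp l n hl fun x hx hxl => ha x
    (Icc_subset_Icc le_rfl (by omega) hx) hxl (by simp at hx; omega)
  have h2 := sparseSum_Icc_left hp l (n + 1) hl fun x hx hxl => ha x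
    (Icc_subset_Icc le_rfl (by push_cast; omega) hx) hxl (by simp at hx; omega)
  rw [show l + ((n + 1 : ℕ) : ℤ) - 1 = (l + n - 1) + 1 by push_cast; ring] at h2
  rw [h1, h2, pow_add _ n 2, endActivity]
  linear_combination (-(1 - p) * lamPF p ^ n) * constD_mul_lamPF_sq hp

end TransferMatrix

/-! ### Non-isolated configurations, unfixed components and windows. -/

section Configurations

theorem thin_eq_one {ω : Config} {x : ℤ} :
    thin ω x = 1 ↔ ω x = 1 ∧ (ω (x - 1) = 1 ∨ ω (x + 1) = 1) := by
  have : ∀ a b c : Fin 2, a * (1 - (1 - b) * (1 - c)) = 1 ↔ a = 1 ∧ (b = 1 ∨ c = 1) := by decide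
  exact this _ _ _

theorem eq_of_eq_one_iff : ∀ {a b : Fin 2}, (a = 1 ↔ b = 1) → a = b := by decide

theorem ext_of_eq_one {ω η : Config} (h : ∀ x, ω x = 1 ↔ η x = 1) : ω = η :=
  funext fun x => eq_of_eq_one_iff (h x)

/-- The thinning map fixes every configuration without isolated points, and its images have none. -/
theorem mem_range_thin {ω : Config} :
    ω ∈ Set.range thin ↔ ∀ x, ω x = 1 → ω (x - 1) = 1 ∨ ω (x + 1) = 1 := by
  constructor
  · rintro ⟨ξ, rfl⟩ x
    simp only [thin_eq_one, sub_add_cancel, add_sub_cancel_right]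
    tauto
  · intro h
    refine ⟨ω, ext_of_eq_one fun x => ?_⟩
    rw [thin_eq_one]
    exact ⟨fun H => H.1, fun H => ⟨H, h x H⟩⟩

theorem NonIso.neighbour (ω : NonIso) {x : ℤ} (h : ω.1 x = 1) :
    ω.1 (x - 1) = 1 ∨ ω.1 (x + 1) = 1 :=
  mem_range_thin.1 ω.2 x h

theorem abs_sub_eq_one_iff {i j : ℤ} : |i - j| = 1 ↔ i = j - 1 ∨ i = j + 1 := by
  rw [abs_eq zero_le_one]
  omega

theorem mem_outerBoundary {Λ : Set ℤ} {x : ℤ} :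
    x ∈ outerBoundary Λ ↔ x ∉ Λ ∧ (x - 1 ∈ Λ ∨ x + 1 ∈ Λ) := by
  simp only [outerBoundary, Set.mem_ofPred_eq, abs_sub_eq_one_iff]
  refine and_congr_right fun _ => ⟨?_, ?_⟩
  · rintro ⟨i, hi, rfl | rfl⟩ <;> simp [hi]
  · rintro (h | h)
    · exact ⟨_, h, Or.inl rfl⟩
    · exact ⟨_, h, Or.inr rfl⟩

theorem mem_latticeClosure {Λ : Set ℤ} {x : ℤ} :
    x ∈ latticeClosure Λ ↔ x ∈ Λ ∨ x - 1 ∈ Λ ∨ x + 1 ∈ Λ := by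
  simp only [latticeClosure, Set.mem_union, mem_outerBoundary]
  tauto

theorem mem_occupied {ω : NonIso} {x : ℤ} : x ∈ occupied ω ↔ ω.1 x = 1 := Iff.rfl

theorem mem_unfixedArea {ω : NonIso} {x : ℤ} :
    x ∈ unfixedArea ω ↔ ω.1 x ≠ 1 ∧ ω.1 (x - 1) ≠ 1 ∧ ω.1 (x + 1) ≠ 1 := by
  simp only [unfixedArea, Set.mem_compl_iff, mem_latticeClosure, mem_occupied]
  tauto

/-- The component of `x` in the unfixed area. -/
abbrev comp (ω : NonIso) (x : ℤ) : Set ℤ := Set.ordConnectedComponent (unfixedArea ω) x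

theorem comp_eq_of_mem {ω : NonIso} {x y : ℤ} (h : y ∈ comp ω x) : comp ω y = comp ω x :=
  (Set.ordConnectedComponent_eq h).symm

theorem ordConnected_of_mem_unfixedComponents {ω : NonIso} {U : Set ℤ}
    (hU : U ∈ unfixedComponents ω) : U.OrdConnected := by
  obtain ⟨x, _, rfl⟩ := hU
  refine Set.ordConnected_iff_uIcc_subset.2 fun y hy z hz w hw => ?_
  have hyz : z ∈ comp ω y := comp_eq_of_mem hy ▸ hz
  rw [Set.mem_ordConnectedComponent] at hyz
  have : w ∈ comp ω y := (Set.uIcc_subset_uIcc_left hw).trans hyz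
  rwa [comp_eq_of_mem hy] at this

theorem eq_comp_of_mem {ω : NonIso} {U : Set ℤ} (hU : U ∈ unfixedComponents ω) {x : ℤ}
    (hx : x ∈ U) : U = comp ω x := by
  obtain ⟨y, _, rfl⟩ := hU
  exact (comp_eq_of_mem hx).symm

theorem subset_of_mem_unfixedComponents {ω : NonIso} {U : Set ℤ} (hU : U ∈ unfixedComponents ω) :
    U ⊆ unfixedArea ω := by
  obtain ⟨y, _, rfl⟩ := hU
  exact Set.ordConnectedComponent_subset

theorem comp_mem_unfixedComponents {ω : NonIso} {x : ℤ} (hx : x ∈ unfixedArea ω) :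
    comp ω x ∈ unfixedComponents ω := ⟨x, hx, rfl⟩

/-- A window `[L, R]` around `Λ` whose ends lie either in an occupied bond or deep inside an
infinite component of the unfixed area. -/
structure IsWindow (Λ : Finset ℤ) (L R : ℤ) (ω : NonIso) : Prop where
  lt : L < R
  subset : ∀ x ∈ Λ, L + 2 ≤ x ∧ x + 2 ≤ R
  left : (ω.1 L = 1 ∧ ω.1 (L + 1) = 1) ∨ ∀ x ≤ L + 1, ω.1 x ≠ 1
  right : (ω.1 R = 1 ∧ ω.1 (R - 1) = 1) ∨ ∀ x, R - 1 ≤ x → ω.1 x ≠ 1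

namespace IsWindow

variable {Λ Δ : Finset ℤ} {L R : ℤ} {ω η : NonIso}

theorem mono (h : IsWindow Δ L R ω) (hΛ : Λ ⊆ Δ) : IsWindow Λ L R ω :=
  ⟨h.lt, fun x hx => h.subset x (hΛ hx), h.left, h.right⟩

theorem notMem_of_le (h : IsWindow Λ L R ω) {x : ℤ} (hx : x ≤ L + 1) : x ∉ Λ := fun hx' => by
  have := (h.subset x hx').1
  omega

theorem notMem_of_ge (h : IsWindow Λ L R ω) {x : ℤ} (hx : R - 1 ≤ x) : x ∉ Λ := fun hx' => by
  have := (h.subset x hx').2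
  omega

theorem congr (h : IsWindow Λ L R ω) (hη : η ∈ sameOff Λ ω) : IsWindow Λ L R η := by
  refine ⟨h.lt, h.subset, ?_, ?_⟩
  · rw [hη _ (h.notMem_of_le (by omega)), hη _ (h.notMem_of_le le_rfl)]
    exact h.left.imp_right fun H x hx => by rw [hη _ (h.notMem_of_le hx)]; exact H x hx
  · rw [hη _ (h.notMem_of_ge (by omega)), hη _ (h.notMem_of_ge le_rfl)]
    exact h.right.imp_right fun H x hx => by rw [hη _ (h.notMem_of_ge hx)]; exact H x hx

theorem left_empty (h : IsWindow Λ L R ω) (hL : ω.1 L ≠ 1) : ∀ x ≤ L + 1, ω.1 x ≠ 1 :=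
  h.left.resolve_left fun H => hL H.1

theorem right_empty (h : IsWindow Λ L R ω) (hR : ω.1 R ≠ 1) : ∀ x, R - 1 ≤ x → ω.1 x ≠ 1 :=
  h.right.resolve_left fun H => hR H.1

end IsWindow

/-- By non-isolation, any occupied site to the left of `m` lies in an occupied bond. If there is
none, the half-line is empty. -/
theorem exists_left_end (ω : NonIso) (m : ℤ) :
    ∃ L ≤ m, (ω.1 L = 1 ∧ ω.1 (L + 1) = 1) ∨ ∀ x ≤ L + 1, ω.1 x ≠ 1 := by
  by_cases h : ∃ x ≤ m, ω.1 x = 1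
  · obtain ⟨x, hx, h1⟩ := h
    rcases ω.neighbour h1 with h2 | h2
    · exact ⟨x - 1, by omega, Or.inl ⟨h2, by rwa [sub_add_cancel]⟩⟩
    · exact ⟨x, hx, Or.inl ⟨h1, h2⟩⟩
  · push Not at h
    exact ⟨m - 1, by omega, Or.inr fun x hx => h x (by omega)⟩

theorem exists_right_end (ω : NonIso) (m : ℤ) :
    ∃ R ≥ m, (ω.1 R = 1 ∧ ω.1 (R - 1) = 1) ∨ ∀ x, R - 1 ≤ x → ω.1 x ≠ 1 := by
  by_cases h : ∃ x ≥ m, ω.1 x = 1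
  · obtain ⟨x, hx, h1⟩ := h
    rcases ω.neighbour h1 with h2 | h2
    · exact ⟨x, hx, Or.inl ⟨h1, h2⟩⟩
    · exact ⟨x + 1, by omega, Or.inl ⟨h2, by rwa [add_sub_cancel_right]⟩⟩
  · push Not at h
    exact ⟨m + 1, by omega, Or.inr fun x hx => h x (by omega)⟩

theorem exists_isWindow (Λ : Finset ℤ) (ω : NonIso) : ∃ L R, IsWindow Λ L R ω := by
  obtain ⟨b, hb⟩ := Λ.bddBelow
  obtain ⟨c, hc⟩ := Λ.bddAbove
  obtain ⟨L, hL, h1⟩ := exists_left_end ω (min (b - 2) 0)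
  obtain ⟨R, hR, h2⟩ := exists_right_end ω (max (c + 2) 1)
  refine ⟨L, R, by omega, fun x hx => ⟨?_, ?_⟩, h1, h2⟩
  · have := hb hx
    omega
  · have := hc hx
    omega

end Configurations

/-! ### Weights of components cut by a window. -/

section Components

variable {p : ℝ} {Λ : Finset ℤ} {L R m M : ℤ} {ω : NonIso} {U : Set ℤ}

theorem rightOfMin_eq (hm : IsLeast (Λ : Set ℤ) m) : rightOfMin Λ = Set.Ici (m - 1) := by
  ext x
  simp only [rightOfMin, Set.mem_ofPred_eq, Set.mem_Ici, mem_latticeClosure]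
  constructor
  · rintro ⟨y, h | h | h, hx⟩ <;> have := hm.2 h <;> omega
  · intro h
    exact ⟨m - 1, Or.inr (Or.inr (by rw [sub_add_cancel]; exact hm.1)), h⟩

theorem leftOfMax_eq (hM : IsGreatest (Λ : Set ℤ) M) : leftOfMax Λ = Set.Iic (M + 1) := by
  ext x
  simp only [leftOfMax, Set.mem_ofPred_eq, Set.mem_Iic, mem_latticeClosure]
  constructor
  · rintro ⟨y, h | h | h, hx⟩ <;> have := hM.2 h <;> omega
  · intro h
    exact ⟨M + 1, Or.inr (Or.inl (by rw [add_sub_cancel_right]; exact hM.1)), h⟩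

/-- The activities in a window, modified at those ends that lie in an infinite component. -/
noncomputable def activity (p : ℝ) (L R : ℤ) (ω : NonIso) (x : ℤ) : ℝ :=
  if ω.1 x ≠ 1 ∧ (x = L ∨ x = R) then endActivity p else p

theorem activity_of_ne {x : ℤ} (h1 : x ≠ L) (h2 : x ≠ R) : activity p L R ω x = p := by
  simp [activity, h1, h2]

theorem IsWindow.Iic_subset (hw : IsWindow Λ L R ω) (hU : U ∈ unfixedComponents ω) (hL : L ∈ U) :
    Set.Iic L ⊆ U := by
  have h1 := hw.left_empty (mem_unfixedArea.1 (subset_of_mem_unfixedComponents hU hL)).1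
  rw [eq_comp_of_mem hU hL]
  refine Set.subset_ordConnectedComponent (Set.mem_Iic.2 le_rfl) fun x hx => ?_
  simp only [Set.mem_Iic] at hx
  exact mem_unfixedArea.2 ⟨h1 _ (by omega), h1 _ (by omega), h1 _ (by omega)⟩

theorem IsWindow.Ici_subset (hw : IsWindow Λ L R ω) (hU : U ∈ unfixedComponents ω) (hR : R ∈ U) :
    Set.Ici R ⊆ U := by
  have h1 := hw.right_empty (mem_unfixedArea.1 (subset_of_mem_unfixedComponents hU hR)).1
  rw [eq_comp_of_mem hU hR]
  refine Set.subset_ordConnectedComponent (Set.mem_Ici.2 le_rfl) fun x hx => ?_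
  simp only [Set.mem_Ici] at hx
  exact mem_unfixedArea.2 ⟨h1 _ (by omega), h1 _ (by omega), h1 _ (by omega)⟩

theorem lt_of_mem_of_notMem (hU : U.OrdConnected) {x y : ℤ} (hx : x ∈ U) (hLx : L ≤ x)
    (hL : L ∉ U) (hy : y ∈ U) : L < y := by
  by_contra! h
  exact hL (hU.out hy hx ⟨h, hLx⟩)

theorem gt_of_mem_of_notMem (hU : U.OrdConnected) {x y : ℤ} (hx : x ∈ U) (hLx : x ≤ R)
    (hR : R ∉ U) (hy : y ∈ U) : y < R := by
  by_contra! h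
  exact hR (hU.out hx hy ⟨hLx, h⟩)

theorem eq_Iic_of_isGreatest {r : ℤ} (hU : U.OrdConnected) (hL : Set.Iic L ⊆ U)
    (hr : IsGreatest U r) : U = Set.Iic r := by
  refine Set.Subset.antisymm (fun x hx => hr.2 hx) fun x hx => ?_
  rcases le_total x L with h | h
  · exact hL h
  · exact hU.out (hL (Set.mem_Iic.2 le_rfl)) hr.1 ⟨h, hx⟩

theorem eq_Ici_of_isLeast {l : ℤ} (hU : U.OrdConnected) (hR : Set.Ici R ⊆ U)
    (hl : IsLeast U l) : U = Set.Ici l := by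
  refine Set.Subset.antisymm (fun x hx => hl.2 hx) fun x hx => ?_
  rcases le_total R x with h | h
  · exact hR h
  · exact hU.out hl.1 (hR (Set.mem_Ici.2 le_rfl)) ⟨hx, h⟩

theorem eq_Icc_of_isLeast_of_isGreatest {l r : ℤ} (hU : U.OrdConnected) (hl : IsLeast U l)
    (hr : IsGreatest U r) : U = Set.Icc l r :=
  Set.Subset.antisymm (fun _ hx => ⟨hl.2 hx, hr.2 hx⟩) (hU.out hl.1 hr.1)

theorem exists_isGreatest_of_lt (hU : U.Nonempty) (h : ∀ x ∈ U, x < R) : ∃ r, IsGreatest U r := by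
  obtain ⟨r, hr, h'⟩ := Int.exists_greatest_of_bdd (P := (· ∈ U)) ⟨R, fun x hx => (h x hx).le⟩ hU
  exact ⟨r, hr, h'⟩

theorem exists_isLeast_of_lt (hU : U.Nonempty) (h : ∀ x ∈ U, L < x) : ∃ l, IsLeast U l := by
  obtain ⟨r, hr, h'⟩ := Int.exists_least_of_bdd (P := (· ∈ U)) ⟨L, fun x hx => (h x hx).le⟩ hU
  exact ⟨r, hr, h'⟩

open Classical in
/-- The weight of a component near `Λ` is, up to the lengths of the infinite ends in the window, the
sparse partition function of its trace on the window. -/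
theorem sparseSum_component (hp : p ∈ Set.Ioo (0 : ℝ) 1) (hw : IsWindow Λ L R ω)
    (hm : IsLeast (Λ : Set ℤ) m) (hM : IsGreatest (Λ : Set ℤ) M) (hU : U ∈ unfixedComponents ω)
    {x : ℤ} (hx : x ∈ U) (hmx : m - 2 ≤ x) (hxM : x ≤ M + 2) :
    sparseSum (activity p L R ω) (1 - p) {y ∈ Icc L R | y ∈ U} =
      componentWeight p Λ U * (if L ∈ U then (1 - p) * lamPF p ^ (m - 1 - L).toNat else 1) *
        (if R ∈ U then (1 - p) * lamPF p ^ (R - (M + 1)).toNat else 1) := by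
  have hq : 1 - p ≠ 0 := by linarith [hp.2]
  have hLm := (hw.subset m hm.1).1
  have hMR := (hw.subset M hM.1).2
  have hmM : m ≤ M := hm.2 hM.1
  have hLx : L ≤ x := by omega
  have hxR : x ≤ R := by omega
  have ho := ordConnected_of_mem_unfixedComponents hU
  have hne : U.Nonempty := ⟨x, hx⟩
  have hact : ∀ y ∈ U, y = L ∨ y = R → activity p L R ω y = endActivity p := fun y hy h => by
    rw [activity, if_pos ⟨(mem_unfixedArea.1 (subset_of_mem_unfixedComponents hU hy)).1, h⟩]
  -- A component containing a window end contains the half-line beyond it. The four cases are `ℤ`, a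
  -- left half-line, a right half-line and a bounded interval.
  by_cases hL : L ∈ U <;> by_cases hR : R ∈ U
  · have hu : U = Set.univ := by
      refine Set.eq_univ_of_forall fun y => ?_
      rcases le_total y L with h | h
      · exact hw.Iic_subset hU hL h
      rcases le_total R y with h' | h'
      · exact hw.Ici_subset hU hR h'
      exact ho.out hL hR ⟨h, h'⟩
    obtain ⟨n, hn⟩ := Int.eq_ofNat_of_zero_le (show 0 ≤ R - L - 1 by have := hw.lt; omega)
    have e : R = L + n + 1 := by omega
    have h1 : {y ∈ Icc L R | y ∈ U} = Icc L (L + n + 1) := by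
      rw [← e, hu]; simp
    rw [h1, sparseSum_Icc_both hp L n (hact _ hL (Or.inl rfl)) (hact _ (e ▸ hR) (Or.inr e.symm))
      fun y hy h h' => activity_of_ne h (e ▸ h'), if_pos hL, if_pos hR]
    have h2 : rightOfMin Λ ∩ leftOfMax Λ = (Icc (m - 1) (M + 1) : Finset ℤ) := by
      rw [rightOfMin_eq hm, leftOfMax_eq hM, Finset.coe_Icc]; rfl
    have h3 : componentWeight p Λ U = (1 - p)⁻¹ * (constD p * lamPF p ^ (M + 3 - m).toNat) := by
      rw [componentWeight, hu, if_neg Set.infinite_univ.not_finite, if_neg not_bddAbove_univ,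
        if_neg not_bddBelow_univ, h2, Set.ncard_coe_finset, Int.card_Icc]
      congr 4
      ring
    -- The window length is `|V₋ ∩ V₊| = M + 3 - m` plus the two overhangs beyond the closure of
    -- `Λ`.
    rw [h3, show n + 2 = (M + 3 - m).toNat + (m - 1 - L).toNat + (R - (M + 1)).toNat by omega,
      pow_add, pow_add]
    field_simp
  · obtain ⟨r, hr⟩ := exists_isGreatest_of_lt hne fun y => gt_of_mem_of_notMem ho hx hxR hR
    have hu := eq_Iic_of_isGreatest ho (hw.Iic_subset hU hL) hr
    have hrR : r < R := gt_of_mem_of_notMem ho hx hxR hR hr.1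
    have hLr : L ≤ r := hr.2 hL
    have hxr : x ≤ r := hr.2 hx
    obtain ⟨n, hn⟩ := Int.eq_ofNat_of_zero_le (show 0 ≤ r - L + 1 by omega)
    have e : r = L + n - 1 := by omega
    have h1 : {y ∈ Icc L R | y ∈ U} = Icc L (L + n - 1) := by
      ext y
      simp only [hu, mem_filter, mem_Icc, Set.mem_Iic]
      omega
    rw [h1, sparseSum_Icc_left hp L n (hact _ hL (Or.inl rfl))
      fun y hy h => activity_of_ne h (by simp at hy; omega), if_pos hL, if_neg hR]
    have h2 : U ∩ rightOfMin Λ = (Icc (m - 1) r : Finset ℤ) := by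
      rw [rightOfMin_eq hm, hu, Finset.coe_Icc, Set.inter_comm]; rfl
    have h3 : componentWeight p Λ U = (1 - p)⁻¹ * lamPF p ^ (r + 2 - m).toNat := by
      rw [componentWeight, if_neg (hu ▸ (Set.Iic_infinite r).not_finite),
        if_pos (hu ▸ bddAbove_Iic), h2, Set.ncard_coe_finset, Int.card_Icc]
      congr 3
      ring
    rw [h3, show n = (r + 2 - m).toNat + (m - 1 - L).toNat by omega, pow_add]
    field_simp
  · obtain ⟨l, hl⟩ := exists_isLeast_of_lt hne fun y => lt_of_mem_of_notMem ho hx hLx hL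
    have hu := eq_Ici_of_isLeast ho (hw.Ici_subset hU hR) hl
    have hLl : L < l := lt_of_mem_of_notMem ho hx hLx hL hl.1
    have hlR : l ≤ R := hl.2 hR
    have hlx : l ≤ x := hl.2 hx
    obtain ⟨n, hn⟩ := Int.eq_ofNat_of_zero_le (show 0 ≤ R - l by omega)
    have e : R = l + n := by omega
    have h1 : {y ∈ Icc L R | y ∈ U} = Icc l (l + n) := by
      ext y
      simp only [hu, mem_filter, mem_Icc, Set.mem_Ici]
      omega
    rw [h1, sparseSum_Icc_right hp l n (hact _ (e ▸ hR) (Or.inr e.symm))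
      fun y hy h => activity_of_ne (by simp at hy; omega) (e ▸ h), if_neg hL, if_pos hR]
    have h2 : U ∩ leftOfMax Λ = (Icc l (M + 1) : Finset ℤ) := by
      rw [leftOfMax_eq hM, hu, Finset.coe_Icc]; rfl
    have h3 : componentWeight p Λ U = (1 - p)⁻¹ * lamPF p ^ (M + 2 - l).toNat := by
      rw [componentWeight, if_neg (hu ▸ (Set.Ici_infinite l).not_finite),
        if_neg (hu ▸ not_bddAbove_Ici l), if_pos (hu ▸ bddBelow_Ici), h2, Set.ncard_coe_finset,
        Int.card_Icc]
      congr 3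
      ring
    rw [h3, show n + 1 = (M + 2 - l).toNat + (R - (M + 1)).toNat by omega, pow_add]
    field_simp
  · obtain ⟨l, hl⟩ := exists_isLeast_of_lt hne fun y => lt_of_mem_of_notMem ho hx hLx hL
    obtain ⟨r, hr⟩ := exists_isGreatest_of_lt hne fun y => gt_of_mem_of_notMem ho hx hxR hR
    have hu := eq_Icc_of_isLeast_of_isGreatest ho hl hr
    have hLl : L < l := lt_of_mem_of_notMem ho hx hLx hL hl.1
    have hrR : r < R := gt_of_mem_of_notMem ho hx hxR hR hr.1
    have hlr : l ≤ r := hl.2 hr.1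
    obtain ⟨n, hn⟩ := Int.eq_ofNat_of_zero_le (show 0 ≤ r - l + 1 by omega)
    have e : r = l + n - 1 := by omega
    have h1 : {y ∈ Icc L R | y ∈ U} = Icc l (l + n - 1) := by
      ext y
      simp only [hu, mem_filter, mem_Icc, Set.mem_Icc]
      omega
    have h2 := sparseSum_Icc_plain hp (a := activity p L R ω) l n
      fun y hy => activity_of_ne (by simp at hy; omega) (by simp at hy; omega)
    have h3 : U.ncard = n := by
      rw [hu, ← Finset.coe_Icc, Set.ncard_coe_finset, Int.card_Icc]
      omega
    rw [h1, if_neg hL, if_neg hR, componentWeight, if_pos (hu ▸ Set.finite_Icc l r), h3, ← h2]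
    field_simp

end Components

/-! ### Window weights are proportional to the weights near `Λ`. -/

section WindowWeight

variable {p : ℝ} {Λ Δ : Finset ℤ} {L R : ℤ} {ω η ξ : NonIso}

theorem activity_pos (hp : p ∈ Set.Ioo (0 : ℝ) 1) (x : ℤ) : 0 < activity p L R ω x := by
  unfold activity endActivity
  split_ifs
  · linarith [one_sub_lt_lamPF hp]
  · exact hp.1

theorem siteWeight_pos {a : ℤ → ℝ} {q : ℝ} (ha : ∀ x, 0 < a x) (hq : 0 < q) (S A : Finset ℤ) :
    0 < siteWeight a q S A :=
  mul_pos (Finset.prod_pos fun x _ => ha x) (pow_pos hq _)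

theorem componentWeight_pos (hp : p ∈ Set.Ioo (0 : ℝ) 1) (Λ U : Set ℤ) :
    0 < componentWeight p Λ U := by
  have h1 := lamPF_pos hp
  have h2 := constD_pos hp
  have h3 : 0 < 1 - p := by linarith [hp.2]
  unfold componentWeight
  refine mul_pos (inv_pos.2 h3) ?_
  split_ifs
  · exact transferMatrix_pow_pos hp _
  all_goals positivity

theorem weight_pos (hp : p ∈ Set.Ioo (0 : ℝ) 1) (Λ : Set ℤ) (ω : NonIso) : 0 < weight p Λ ω := by
  have h3 : 0 < 1 - p := by linarith [hp.2]
  have h4 := hp.1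
  unfold weight
  refine mul_pos (by positivity) ?_
  exact finprod_mem_induction (fun x : ℝ => 0 < x) one_pos (fun _ _ => mul_pos)
    fun U _ => componentWeight_pos hp Λ U

/-- The occupied sites in the window `[L, R]`. -/
noncomputable def occupiedIn (L R : ℤ) (ω : NonIso) : Finset ℤ := {x ∈ Icc L R | ω.1 x = 1}

theorem mem_occupiedIn {x : ℤ} : x ∈ occupiedIn L R ω ↔ (L ≤ x ∧ x ≤ R) ∧ ω.1 x = 1 := by
  simp [occupiedIn]

theorem IsWindow.nonIsolated_occupiedIn (hw : IsWindow Λ L R ω) :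
    nonIsolated (occupiedIn L R ω) = occupiedIn L R ω := by
  refine Finset.filter_true_of_mem fun x hx => ?_
  simp only [mem_occupiedIn] at hx ⊢
  obtain ⟨⟨h1, h2⟩, h3⟩ := hx
  have hlt := hw.lt
  rcases eq_or_lt_of_le h1 with rfl | h1
  · right
    rcases hw.left with h | h
    · exact ⟨by omega, h.2⟩
    · exact absurd h3 (h _ (by omega))
  rcases eq_or_lt_of_le h2 with rfl | h2
  · left
    rcases hw.right with h | h
    · exact ⟨by omega, h.2⟩
    · exact absurd h3 (h _ (by omega))
  · exact (ω.neighbour h3).imp (fun h => ⟨by omega, h⟩) fun h => ⟨by omega, h⟩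

/-- The total weight of the configurations in the window `[L, R]` with non-isolated part `ω`. -/
noncomputable def windowWeight (p : ℝ) (L R : ℤ) (ω : NonIso) : ℝ :=
  ∑ A ∈ (Icc L R).powerset with nonIsolated A = occupiedIn L R ω,
    siteWeight (activity p L R ω) (1 - p) (Icc L R) A

theorem windowWeight_pos (hp : p ∈ Set.Ioo (0 : ℝ) 1) (hw : IsWindow Λ L R ω) :
    0 < windowWeight p L R ω :=
  Finset.sum_pos (fun A _ => siteWeight_pos (activity_pos hp) (by linarith [hp.2]) _ A)
    ⟨occupiedIn L R ω, by
      simp only [mem_filter, mem_powerset]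
      exact ⟨filter_subset _ _, hw.nonIsolated_occupiedIn⟩⟩

open Classical in
/-- The components of the unfixed area that meet the window `[L, R]`. -/
noncomputable def windowComponents (L R : ℤ) (ω : NonIso) : Finset (Set ℤ) :=
  {x ∈ Icc L R | x ∈ unfixedArea ω}.image (comp ω)

theorem mem_windowComponents {U : Set ℤ} :
    U ∈ windowComponents L R ω ↔ U ∈ unfixedComponents ω ∧ ∃ x ∈ U, L ≤ x ∧ x ≤ R := by
  simp only [windowComponents, mem_image, mem_filter, mem_Icc]
  constructor
  · rintro ⟨x, ⟨h1, h2⟩, rfl⟩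
    exact ⟨comp_mem_unfixedComponents h2, x, Set.self_mem_ordConnectedComponent.2 h2, h1⟩
  · rintro ⟨hU, x, hx, h⟩
    exact ⟨x, ⟨h, subset_of_mem_unfixedComponents hU hx⟩, (eq_comp_of_mem hU hx).symm⟩

open Classical in
/-- The sparse partition function of the trace of `U` on the window. -/
noncomputable def traceSum (p : ℝ) (L R : ℤ) (ω : NonIso) (U : Set ℤ) : ℝ :=
  sparseSum (activity p L R ω) (1 - p) {y ∈ Icc L R | y ∈ U}

/-- Neighbouring sites of the unfixed area share a component. The separation is what
`sparseSum_biUnion` needs. -/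
theorem one_lt_abs_sub_of_mem {U V : Set ℤ} (hU : U ∈ unfixedComponents ω)
    (hV : V ∈ unfixedComponents ω) (hne : U ≠ V) {x y : ℤ} (hx : x ∈ U) (hy : y ∈ V) :
    1 < |x - y| := by
  by_contra! h
  refine hne ?_
  rw [eq_comp_of_mem hU hx, eq_comp_of_mem hV hy]
  refine Set.ordConnectedComponent_eq fun z hz => ?_
  have : z = x ∨ z = y := by
    rw [abs_le] at h
    rw [Set.mem_uIcc] at hz
    omega
  rcases this with rfl | rfl
  · exact subset_of_mem_unfixedComponents hU hx
  · exact subset_of_mem_unfixedComponents hV hy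

/-- Beyond an empty end of the window the configuration is empty as well, so truncating to the
window changes neither the boundary nor the unfixed area inside it. The sum over the fibre then
factorises over components; occupied sites always carry activity `p`, as only empty ends are
modified. -/
theorem IsWindow.windowWeight_eq (hw : IsWindow Λ L R ω) :
    windowWeight p L R ω = p ^ (occupied ω ∩ Set.Icc L R).ncard *
      (1 - p) ^ (outerBoundary (occupied ω) ∩ Set.Icc L R).ncard *
      ∏ U ∈ windowComponents L R ω, traceSum p L R ω U := by
  classical
  have hlt := hw.lt
  have hmem : ∀ {x}, L ≤ x → x ≤ R → (ω.1 x = 1 ↔ x ∈ occupiedIn L R ω) := fun h1 h2 => by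
    simp [mem_occupiedIn, h1, h2]
  have hnb : ∀ x ∈ Icc L R, (ω.1 x ≠ 1 → ((x - 1 ∈ occupiedIn L R ω ↔ ω.1 (x - 1) = 1) ∧
      (x + 1 ∈ occupiedIn L R ω ↔ ω.1 (x + 1) = 1))) := by
    intro x hx h
    simp only [mem_Icc] at hx
    simp only [mem_occupiedIn]
    constructor
    · refine ⟨fun H => H.2, fun H => ⟨⟨?_, by omega⟩, H⟩⟩
      by_contra hc
      have : x = L := by omega
      subst this
      exact hw.left_empty h _ (by omega) H
    · refine ⟨fun H => H.2, fun H => ⟨⟨by omega, ?_⟩, H⟩⟩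
      by_contra hc
      have : x = R := by omega
      subst this
      exact hw.right_empty h _ (by omega) H
  rw [windowWeight, sum_nonIsolated_eq _ _ hw.nonIsolated_occupiedIn (filter_subset _ _)]
  congr 1
  · congr 1
    · have h1 : occupied ω ∩ Set.Icc L R = (occupiedIn L R ω : Finset ℤ) := by
        ext x
        simp only [Set.mem_inter_iff, mem_occupied, Set.mem_Icc, mem_coe, mem_occupiedIn]
        tauto
      rw [h1, Set.ncard_coe_finset, ← Finset.prod_const]
      refine Finset.prod_congr rfl fun x hx => ?_
      simp [activity, (mem_occupiedIn.1 hx).2]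
    · rw [← Set.ncard_coe_finset]
      congr 2
      ext x
      simp only [Set.mem_inter_iff, mem_outerBoundary, mem_occupied, Set.mem_Icc, mem_coe,
        mem_filter, mem_Icc]
      by_cases hx : L ≤ x ∧ x ≤ R
      · rw [← hmem hx.1 hx.2]
        have := hnb x (mem_Icc.2 hx)
        tauto
      · tauto
  · unfold traceSum
    rw [← sparseSum_biUnion]
    · congr 1
      ext x
      simp only [mem_filter, mem_biUnion, mem_Icc]
      by_cases hx : L ≤ x ∧ x ≤ R
      · have h1 : (x ∉ occupiedIn L R ω ∧ x - 1 ∉ occupiedIn L R ω ∧ x + 1 ∉ occupiedIn L R ω) ↔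
            x ∈ unfixedArea ω := by
          rw [mem_unfixedArea, ← hmem hx.1 hx.2]
          have := hnb x (mem_Icc.2 hx)
          tauto
        rw [h1]
        constructor
        · rintro ⟨-, h⟩
          refine ⟨comp ω x, mem_windowComponents.2 ⟨comp_mem_unfixedComponents h, x, ?_, hx⟩, hx, ?_⟩
          all_goals exact Set.self_mem_ordConnectedComponent.2 h
        · rintro ⟨U, hU, -, hxU⟩
          exact ⟨hx, subset_of_mem_unfixedComponents (mem_windowComponents.1 hU).1 hxU⟩
      · tauto
    · intro U hU V hV hne x hx y hy
      simp only [mem_filter] at hx hy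
      exact one_lt_abs_sub_of_mem (mem_windowComponents.1 hU).1 (mem_windowComponents.1 hV).1 hne
        hx.2 hy.2

theorem exists_near_of_mem_unfixedComponentsNear {m M : ℤ} {U : Set ℤ}
    (hm : IsLeast (Λ : Set ℤ) m) (hM : IsGreatest (Λ : Set ℤ) M)
    (hU : U ∈ unfixedComponentsNear Λ ω) :
    ∃ y ∈ U, m - 2 ≤ y ∧ y ≤ M + 2 := by
  obtain ⟨-, x, hx, y, hy, hxy⟩ := hU
  refine ⟨y, hy, ?_⟩
  rw [abs_le] at hxy
  rw [mem_latticeClosure] at hx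
  rcases hx with h | h | h <;> have := hm.2 h <;> have := hM.2 h <;> omega

open Classical in
theorem weight_eq_prod_windowComponents (hw : IsWindow Λ L R ω) (hΛ : Λ.Nonempty) :
    weight p Λ ω = p ^ (occupied ω ∩ latticeClosure Λ).ncard *
      (1 - p) ^ (outerBoundary (occupied ω) ∩ latticeClosure Λ).ncard *
      ∏ U ∈ windowComponents L R ω with U ∈ unfixedComponentsNear Λ ω,
        componentWeight p Λ U := by
  rw [weight, ← finprod_mem_coe_finset]
  refine congrArg _ (finprod_mem_congr ?_ fun _ _ => rfl)
  ext U
  rw [mem_coe, mem_filter]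
  refine ⟨fun h => ⟨mem_windowComponents.2 ⟨h.1, ?_⟩, h⟩, fun h => h.2⟩
  have hm := Λ.isLeast_min' hΛ
  have hM := Λ.isGreatest_max' hΛ
  obtain ⟨y, hy, h1, h2⟩ := exists_near_of_mem_unfixedComponentsNear hm hM h
  have := (hw.subset _ hm.1).1
  have := (hw.subset _ hM.1).2
  exact ⟨y, hy, by omega, by omega⟩

/-- An interval that contains `L` and comes near `Λ` also contains `m - 2`. Hence at most one near
component carries the left end factor, and whether one does is decided by spins to the left of `Λ`.
-/
theorem left_mem_iff_of_near {m M : ℤ} {U : Set ℤ} (hw : IsWindow Λ L R ω)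
    (hm : IsLeast (Λ : Set ℤ) m) (hM : IsGreatest (Λ : Set ℤ) M)
    (hU : U ∈ unfixedComponentsNear Λ ω) :
    L ∈ U ↔ (∀ x ≤ m - 1, ω.1 x ≠ 1) ∧ U = comp ω (m - 2) := by
  have hLm := (hw.subset m hm.1).1
  constructor
  · intro hL
    obtain ⟨y, hy, h1, -⟩ := exists_near_of_mem_unfixedComponentsNear hm hM hU
    have h2 : m - 2 ∈ U :=
      (ordConnected_of_mem_unfixedComponents hU.1).out hL hy ⟨by omega, h1⟩
    refine ⟨fun x hx => ?_, eq_comp_of_mem hU.1 h2⟩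
    rcases le_total x L with h | h
    · exact (mem_unfixedArea.1
        (subset_of_mem_unfixedComponents hU.1 (hw.Iic_subset hU.1 hL h))).1
    · rcases eq_or_lt_of_le hx with rfl | hx
      · have := (mem_unfixedArea.1 (subset_of_mem_unfixedComponents hU.1 h2)).2.2
        rwa [show m - 2 + 1 = m - 1 by ring] at this
      · exact (mem_unfixedArea.1 (subset_of_mem_unfixedComponents hU.1
          ((ordConnected_of_mem_unfixedComponents hU.1).out hL h2 ⟨h, by omega⟩))).1
  · rintro ⟨h, rfl⟩
    refine Set.subset_ordConnectedComponent (s := Set.Iic (m - 2)) (Set.mem_Iic.2 le_rfl)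
      (fun x hx => ?_) (Set.mem_Iic.2 (by omega))
    simp only [Set.mem_Iic] at hx
    exact mem_unfixedArea.2 ⟨h _ (by omega), h _ (by omega), h _ (by omega)⟩

theorem right_mem_iff_of_near {m M : ℤ} {U : Set ℤ} (hw : IsWindow Λ L R ω)
    (hm : IsLeast (Λ : Set ℤ) m) (hM : IsGreatest (Λ : Set ℤ) M)
    (hU : U ∈ unfixedComponentsNear Λ ω) :
    R ∈ U ↔ (∀ x, M + 1 ≤ x → ω.1 x ≠ 1) ∧ U = comp ω (M + 2) := by
  have hMR := (hw.subset M hM.1).2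
  constructor
  · intro hR
    obtain ⟨y, hy, -, h1⟩ := exists_near_of_mem_unfixedComponentsNear hm hM hU
    have h2 : M + 2 ∈ U :=
      (ordConnected_of_mem_unfixedComponents hU.1).out hy hR ⟨h1, by omega⟩
    refine ⟨fun x hx => ?_, eq_comp_of_mem hU.1 h2⟩
    rcases le_total R x with h | h
    · exact (mem_unfixedArea.1
        (subset_of_mem_unfixedComponents hU.1 (hw.Ici_subset hU.1 hR h))).1
    · rcases eq_or_lt_of_le hx with rfl | hx
      · have := (mem_unfixedArea.1 (subset_of_mem_unfixedComponents hU.1 h2)).2.1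
        rwa [show M + 2 - 1 = M + 1 by ring] at this
      · exact (mem_unfixedArea.1 (subset_of_mem_unfixedComponents hU.1
          ((ordConnected_of_mem_unfixedComponents hU.1).out h2 hR ⟨by omega, h⟩))).1
  · rintro ⟨h, rfl⟩
    refine Set.subset_ordConnectedComponent (s := Set.Ici (M + 2)) (Set.mem_Ici.2 le_rfl)
      (fun x hx => ?_) (Set.mem_Ici.2 (by omega))
    simp only [Set.mem_Ici] at hx
    exact mem_unfixedArea.2 ⟨h _ (by omega), h _ (by omega), h _ (by omega)⟩

theorem left_comp_mem_near {m : ℤ} (hm : IsLeast (Λ : Set ℤ) m)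
    (h : ∀ x ≤ m - 1, ω.1 x ≠ 1) : comp ω (m - 2) ∈ unfixedComponentsNear Λ ω := by
  have h1 : m - 2 ∈ unfixedArea ω :=
    mem_unfixedArea.2 ⟨h _ (by omega), h _ (by omega), h _ (by omega)⟩
  refine ⟨comp_mem_unfixedComponents h1, m - 1, mem_latticeClosure.2 (Or.inr (Or.inr ?_)), m - 2,
    Set.self_mem_ordConnectedComponent.2 h1, by norm_num⟩
  rw [sub_add_cancel]
  exact hm.1

theorem right_comp_mem_near {M : ℤ} (hM : IsGreatest (Λ : Set ℤ) M)
    (h : ∀ x, M + 1 ≤ x → ω.1 x ≠ 1) : comp ω (M + 2) ∈ unfixedComponentsNear Λ ω := by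
  have h1 : M + 2 ∈ unfixedArea ω :=
    mem_unfixedArea.2 ⟨h _ (by omega), h _ (by omega), h _ (by omega)⟩
  refine ⟨comp_mem_unfixedComponents h1, M + 1, mem_latticeClosure.2 (Or.inr (Or.inl ?_)), M + 2,
    Set.self_mem_ordConnectedComponent.2 h1, by norm_num⟩
  rw [add_sub_cancel_right]
  exact hM.1

open Classical in
/-- The factor between the weight of a configuration in a window and its weight near `Λ`. -/
noncomputable def farFactor (p : ℝ) (Λ : Finset ℤ) (L R m M : ℤ) (ω : NonIso) : ℝ :=
  p ^ (occupied ω ∩ (Set.Icc L R \ latticeClosure Λ)).ncard *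
    (1 - p) ^ (outerBoundary (occupied ω) ∩ (Set.Icc L R \ latticeClosure Λ)).ncard *
    (∏ U ∈ windowComponents L R ω with U ∉ unfixedComponentsNear Λ ω, traceSum p L R ω U) *
    (if ∀ x ≤ m - 1, ω.1 x ≠ 1 then (1 - p) * lamPF p ^ (m - 1 - L).toNat else 1) *
    (if ∀ x, M + 1 ≤ x → ω.1 x ≠ 1 then (1 - p) * lamPF p ^ (R - (M + 1)).toNat else 1)

theorem IsWindow.latticeClosure_subset (hw : IsWindow Λ L R ω) :
    latticeClosure Λ ⊆ Set.Icc L R := by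
  intro x hx
  rw [mem_latticeClosure] at hx
  rw [Set.mem_Icc]
  rcases hx with h | h | h <;> have := hw.subset _ h <;> omega

theorem ncard_inter_add (S : Set ℤ) {K : Set ℤ} (hK : K ⊆ Set.Icc L R) :
    (S ∩ Set.Icc L R).ncard = (S ∩ K).ncard + (S ∩ (Set.Icc L R \ K)).ncard := by
  rw [← Set.ncard_union_eq (Set.disjoint_of_subset Set.inter_subset_right Set.inter_subset_right
      Set.disjoint_sdiff_right) ((Set.finite_Icc L R).subset fun x hx => hK hx.2)
      ((Set.finite_Icc L R).subset fun x hx => hx.2.1), ← Set.inter_union_distrib_left,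
    Set.union_sdiff_cancel hK]

open Classical in
theorem prod_ite_and_eq {ι : Type*} {V : Finset ι} {P : Prop} {a : ι} {c : ℝ} (h : P → a ∈ V) :
    ∏ U ∈ V, (if P ∧ U = a then c else 1) = if P then c else 1 := by
  by_cases hP : P
  · simp [hP, h hP]
  · simp [hP]

/-- Sites are split along the closure of `Λ`, components into near and far ones. For near components
`sparseSum_component` turns trace sums into the weights `Z(U)`, up to one end factor per empty side.
-/
theorem IsWindow.windowWeight_eq_mul (hp : p ∈ Set.Ioo (0 : ℝ) 1) (hw : IsWindow Λ L R ω)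
    {m M : ℤ} (hm : IsLeast (Λ : Set ℤ) m) (hM : IsGreatest (Λ : Set ℤ) M) :
    windowWeight p L R ω = weight p Λ ω * farFactor p Λ L R m M ω := by
  classical
  rw [hw.windowWeight_eq, weight_eq_prod_windowComponents hw ⟨m, hm.1⟩,
    ncard_inter_add _ hw.latticeClosure_subset, ncard_inter_add _ hw.latticeClosure_subset,
    ← Finset.prod_filter_mul_prod_filter_not _ (fun U => U ∈ unfixedComponentsNear Λ ω), farFactor,
    pow_add, pow_add]
  have hLm := (hw.subset m hm.1).1
  have hMR := (hw.subset M hM.1).2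
  have hmM : m ≤ M := hm.2 hM.1
  have hnear : ∏ U ∈ windowComponents L R ω with U ∈ unfixedComponentsNear Λ ω,
      traceSum p L R ω U =
      (∏ U ∈ windowComponents L R ω with U ∈ unfixedComponentsNear Λ ω, componentWeight p Λ U) *
      (if ∀ x ≤ m - 1, ω.1 x ≠ 1 then (1 - p) * lamPF p ^ (m - 1 - L).toNat else 1) *
      (if ∀ x, M + 1 ≤ x → ω.1 x ≠ 1 then (1 - p) * lamPF p ^ (R - (M + 1)).toNat else 1) := by
    have h1 : ∀ U ∈ (windowComponents L R ω).filter (fun U => U ∈ unfixedComponentsNear Λ ω),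
        traceSum p L R ω U = componentWeight p Λ U *
        (if L ∈ U then (1 - p) * lamPF p ^ (m - 1 - L).toNat else 1) *
        (if R ∈ U then (1 - p) * lamPF p ^ (R - (M + 1)).toNat else 1) := by
      intro U hU
      have hU' := (mem_filter.1 hU).2
      obtain ⟨y, hy, h1, h2⟩ := exists_near_of_mem_unfixedComponentsNear hm hM hU'
      exact sparseSum_component hp hw hm hM hU'.1 hy h1 h2
    rw [Finset.prod_congr rfl h1, Finset.prod_mul_distrib, Finset.prod_mul_distrib]
    congr 1
    · congr 1
      rw [Finset.prod_congr rfl fun U hU => by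
        rw [if_congr (left_mem_iff_of_near hw hm hM (mem_filter.1 hU).2) rfl rfl]]
      refine prod_ite_and_eq fun h => ?_
      have h2 := left_comp_mem_near hm h
      exact mem_filter.2 ⟨mem_windowComponents.2 ⟨h2.1, m - 2,
        Set.self_mem_ordConnectedComponent.2 (mem_unfixedArea.2
          ⟨h _ (by omega), h _ (by omega), h _ (by omega)⟩), by omega, by omega⟩, h2⟩
    · rw [Finset.prod_congr rfl fun U hU => by
        rw [if_congr (right_mem_iff_of_near hw hm hM (mem_filter.1 hU).2) rfl rfl]]
      refine prod_ite_and_eq fun h => ?_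
      have h2 := right_comp_mem_near hM h
      exact mem_filter.2 ⟨mem_windowComponents.2 ⟨h2.1, M + 2,
        Set.self_mem_ordConnectedComponent.2 (mem_unfixedArea.2
          ⟨h _ (by omega), h _ (by omega), h _ (by omega)⟩), by omega, by omega⟩, h2⟩
  rw [hnear]
  ring

theorem activity_congr (hw : IsWindow Λ L R ω) (hη : η ∈ sameOff Λ ω) :
    activity p L R η = activity p L R ω := by
  funext x
  unfold activity
  by_cases hx : x = L ∨ x = R
  · rw [hη x]
    rcases hx with rfl | rfl
    · exact hw.notMem_of_le (by omega)
    · exact hw.notMem_of_ge (by omega)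
  · simp [hx]

theorem sameOff_comm (h : η ∈ sameOff Λ ω) : ω ∈ sameOff Λ η := fun i hi => (h i hi).symm

theorem mem_unfixedArea_congr (hη : η ∈ sameOff Λ ω) {x : ℤ} (hx : x ∉ latticeClosure Λ) :
    x ∈ unfixedArea η ↔ x ∈ unfixedArea ω := by
  rw [mem_latticeClosure] at hx
  push Not at hx
  rw [mem_unfixedArea, mem_unfixedArea, hη x hx.1, hη _ hx.2.1, hη _ hx.2.2]

theorem mem_outerBoundary_congr (hη : η ∈ sameOff Λ ω) {x : ℤ} (hx : x ∉ latticeClosure Λ) :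
    x ∈ outerBoundary (occupied η) ↔ x ∈ outerBoundary (occupied ω) := by
  rw [mem_latticeClosure] at hx
  push Not at hx
  simp only [mem_outerBoundary, mem_occupied]
  rw [hη x hx.1, hη _ hx.2.1, hη _ hx.2.2]

/-- Components away from `Λ` are shared by configurations that agree off `Λ`. -/
theorem far_component_congr (hη : η ∈ sameOff Λ ω) {U : Set ℤ} (hU : U ∈ unfixedComponents ω)
    (hfar : U ∉ unfixedComponentsNear Λ ω) :
    U ∈ unfixedComponents η ∧ U ∉ unfixedComponentsNear Λ η := by
  have h1 : ∀ x ∈ U, ∀ y, |y - x| ≤ 1 → y ∉ latticeClosure Λ := fun x hx y hxy hy =>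
    hfar ⟨hU, y, hy, x, hx, hxy⟩
  have h2 : U ⊆ unfixedArea η := fun x hx =>
    (mem_unfixedArea_congr hη (h1 x hx x (by simp))).2 (subset_of_mem_unfixedComponents hU hx)
  -- Sites next to a far component avoid the closure of `Λ`, where both unfixed areas coincide; so
  -- `U` absorbs every adjacent unfixed site of `η`.
  have h3 : ∀ x ∈ U, ∀ y ∈ unfixedArea η, |y - x| ≤ 1 → y ∈ U := by
    intro x hx y hy hxy
    have hy' := (mem_unfixedArea_congr hη (h1 x hx y hxy)).1 hy
    rw [eq_comp_of_mem hU hx, Set.mem_ordConnectedComponent]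
    intro z hz
    have : z = x ∨ z = y := by
      rw [abs_le] at hxy
      rw [Set.mem_uIcc] at hz
      omega
    rcases this with rfl | rfl
    · exact subset_of_mem_unfixedComponents hU hx
    · exact hy'
  obtain ⟨x, hx⟩ : U.Nonempty := by
    obtain ⟨x, hx, rfl⟩ := hU
    exact ⟨x, Set.self_mem_ordConnectedComponent.2 hx⟩
  have h4 : U = comp η x := by
    have := ordConnected_of_mem_unfixedComponents hU
    refine Set.Subset.antisymm (Set.subset_ordConnectedComponent hx h2) fun z hz => ?_
    rw [Set.mem_ordConnectedComponent] at hz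
    -- Walking from `x` to `z` site by site, `h3` keeps every step inside `U`.
    have hr : ∀ n : ℕ, x + n ≤ z → x + n ∈ U := by
      intro n
      induction n with
      | zero => intro _; simpa using hx
      | succ n ih =>
        intro hn
        push_cast at hn ⊢
        refine h3 _ (ih (by omega)) _ (hz ?_) ?_
        · rw [Set.mem_uIcc]; omega
        · rw [abs_le]; omega
    have hl : ∀ n : ℕ, z ≤ x - n → x - n ∈ U := by
      intro n
      induction n with
      | zero => intro _; simpa using hx
      | succ n ih =>
        intro hn
        push_cast at hn ⊢
        refine h3 _ (ih (by omega)) _ (hz ?_) ?_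
        · rw [Set.mem_uIcc]; omega
        · rw [abs_le]; omega
    rcases le_total x z with h | h
    · have := hr (z - x).toNat (by omega)
      rwa [show x + ((z - x).toNat : ℤ) = z by omega] at this
    · have := hl (x - z).toNat (by omega)
      rwa [show x - ((x - z).toNat : ℤ) = z by omega] at this
  refine ⟨⟨x, h2 hx, h4⟩, ?_⟩
  rintro ⟨-, y, hy, z, hz, hyz⟩
  exact h1 z hz y hyz hy

/-- Each factor is determined by spins off `Λ`: far sites, far components, and emptiness of the two
sides. -/
theorem IsWindow.farFactor_congr (hw : IsWindow Λ L R ω) (hη : η ∈ sameOff Λ ω)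
    {m M : ℤ} (hm : IsLeast (Λ : Set ℤ) m) (hM : IsGreatest (Λ : Set ℤ) M) :
    farFactor p Λ L R m M η = farFactor p Λ L R m M ω := by
  classical
  unfold farFactor
  congr 1
  · congr 1
    · congr 1
      · congr 3
        · ext x
          refine and_congr_left fun hx => ?_
          rw [mem_occupied, mem_occupied, hη x]
          exact fun h => hx.2 (mem_latticeClosure.2 (Or.inl h))
        · ext x
          exact and_congr_left fun hx => mem_outerBoundary_congr hη hx.2
      · refine Finset.prod_congr ?_ fun U _ => ?_
        · ext U
          simp only [mem_filter, mem_windowComponents]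
          constructor
          · rintro ⟨⟨h1, h2⟩, h3⟩
            have := far_component_congr (sameOff_comm hη) h1 h3
            exact ⟨⟨this.1, h2⟩, this.2⟩
          · rintro ⟨⟨h1, h2⟩, h3⟩
            have := far_component_congr hη h1 h3
            exact ⟨⟨this.1, h2⟩, this.2⟩
        · rw [traceSum, traceSum, activity_congr hw hη]
    · refine if_congr (forall₂_congr fun x hx => ?_) rfl rfl
      rw [hη x]
      intro h
      have := hm.2 h
      omega
  · refine if_congr (forall₂_congr fun x hx => ?_) rfl rfl
    rw [hη x]
    intro h
    have := hM.2 h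
    omega

/-- In a window, the weights of configurations that agree off `Λ` are proportional to the weights
near `Λ`. -/
theorem IsWindow.weight_mul_windowWeight (hp : p ∈ Set.Ioo (0 : ℝ) 1) (hw : IsWindow Λ L R ω)
    (hη : η ∈ sameOff Λ ω) :
    weight p Λ η * windowWeight p L R ω = weight p Λ ω * windowWeight p L R η := by
  rcases Λ.eq_empty_or_nonempty with rfl | hΛ
  · rw [show η = ω from Subtype.ext (funext fun i => hη i (notMem_empty i))]
  have hm := Λ.isLeast_min' hΛ
  have hM := Λ.isGreatest_max' hΛ
  rw [hw.windowWeight_eq_mul hp hm hM, (hw.congr hη).windowWeight_eq_mul hp hm hM,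
    hw.farFactor_congr hη hm hM]
  ring

theorem sameOff_mono (h : Λ ⊆ Δ) (hη : η ∈ sameOff Λ ω) : η ∈ sameOff Δ ω :=
  fun i hi => hη i fun hiΛ => hi (h hiΛ)

/-- Weights for nested observation windows are consistent. -/
theorem weight_mul_weight (hp : p ∈ Set.Ioo (0 : ℝ) 1) (hΛΔ : Λ ⊆ Δ)
    (hη : η ∈ sameOff Λ ω) :
    weight p Δ η * weight p Λ ω = weight p Δ ω * weight p Λ η := by
  obtain ⟨L, R, hw⟩ := exists_isWindow Δ ω
  have h1 := hw.weight_mul_windowWeight hp (sameOff_mono hΛΔ hη)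
  have h2 := (hw.mono hΛΔ).weight_mul_windowWeight hp hη
  have h3 := windowWeight_pos hp hw
  have h4 := windowWeight_pos hp (hw.congr (sameOff_mono hΛΔ hη))
  -- A window for `Δ` is also one for `Λ`, so both proportionalities involve the same window
  -- weights, which cancel.
  refine mul_right_cancel₀ (mul_pos h3 h4).ne' ?_
  linear_combination weight p Λ ω * windowWeight p L R η * h1 -
    weight p Δ ω * windowWeight p L R η * h2

end WindowWeight

open MeasureTheory

/-! ### Events and functions of the spins in a given set. -/

section LocalEvents

theorem cylinderEvents_le_comap_restrict (Δ : Set ℤ) :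
    cylinderEvents (X := fun _ : ℤ => Fin 2) Δ ≤
      MeasurableSpace.comap (fun (ω : Config) (i : Δ) => ω i) MeasurableSpace.pi := by
  refine iSup₂_le fun i hi => ?_
  have : (fun σ : Config => σ i) =
      (fun τ : Δ → Fin 2 => τ ⟨i, hi⟩) ∘ (fun (ω : Config) (i : Δ) => ω i) := rfl
  rw [this, ← MeasurableSpace.comap_comp]
  exact MeasurableSpace.comap_mono (measurable_pi_apply _).comap_le

theorem mem_congr_of_cylinderEvents {Δ : Set ℤ} {B : Set Config}
    (hB : MeasurableSet[cylinderEvents (X := fun _ : ℤ => Fin 2) Δ] B) {ω η : Config}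
    (h : ∀ x ∈ Δ, ω x = η x) : ω ∈ B ↔ η ∈ B := by
  obtain ⟨t, -, rfl⟩ := cylinderEvents_le_comap_restrict Δ B hB
  have : (fun i : Δ => ω i) = fun i : Δ => η i := funext fun i => h i i.2
  simp only [Set.mem_preimage, this]

theorem mem_congr_of_eventsIn {Δ : Set ℤ} {A : Set NonIso} (hA : MeasurableSet[eventsIn Δ] A)
    {ω η : NonIso} (h : ∀ x ∈ Δ, ω.1 x = η.1 x) : ω ∈ A ↔ η ∈ A := by
  obtain ⟨B, hB, rfl⟩ := hA
  exact mem_congr_of_cylinderEvents hB h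

theorem eventsIn_le (Δ : Set ℤ) : eventsIn Δ ≤ (inferInstance : MeasurableSpace NonIso) :=
  MeasurableSpace.comap_mono cylinderEvents_le_pi

theorem eventsIn_mono {Δ Δ' : Set ℤ} (h : Δ ⊆ Δ') : eventsIn Δ ≤ eventsIn Δ' :=
  MeasurableSpace.comap_mono (cylinderEvents_mono h)

theorem measurable_apply_eventsIn {Δ : Set ℤ} {x : ℤ} (hx : x ∈ Δ) :
    Measurable[eventsIn Δ] fun ω : NonIso => ω.1 x := by
  intro s hs
  exact ⟨_, measurable_cylinderEvent_apply (X := fun _ : ℤ => Fin 2) hx hs, rfl⟩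

theorem measurableSet_eventsIn_apply {Δ : Set ℤ} {x : ℤ} (hx : x ∈ Δ) :
    MeasurableSet[eventsIn Δ] {ω : NonIso | ω.1 x = 1} :=
  measurable_apply_eventsIn hx (measurableSet_singleton 1)

/-- Functions of finitely many spins are measurable with respect to these spins. -/
theorem measurable_eventsIn_of_congr {α : Type*} [MeasurableSpace α] {J : Finset ℤ}
    {f : NonIso → α} (h : ∀ ω η : NonIso, (∀ x ∈ J, ω.1 x = η.1 x) → f ω = f η) :
    Measurable[eventsIn (J : Set ℤ)] f := by
  intro s _
  let r : NonIso → (J → Fin 2) := fun ω i => ω.1 i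
  have hr : Measurable[eventsIn (J : Set ℤ)] r := by
    rw [@measurable_pi_iff]
    exact fun i => measurable_apply_eventsIn (mem_coe.2 i.2)
  have : f ⁻¹' s = r ⁻¹' (r '' (f ⁻¹' s)) := by
    refine Set.Subset.antisymm (Set.subset_preimage_image _ _) ?_
    rintro ω ⟨η, hη, e⟩
    have := h η ω fun x hx => congrFun e ⟨x, hx⟩
    rwa [Set.mem_preimage, ← this]
  rw [this]
  exact hr (Set.toFinite _).measurableSet

end LocalEvents

/-! ### Window configurations continued by the boundary condition. -/

section Glue

variable {p : ℝ} {Λ Δ : Finset ℤ} {L R : ℤ} {ω η ξ : NonIso}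

/-- The configuration that is the non-isolated part of `A` in the window, and `ω` outside. -/
noncomputable def glue (L R : ℤ) (ω : NonIso) (A : Finset ℤ) : Config :=
  fun x => if x ∈ Icc L R then (if x ∈ nonIsolated A then 1 else 0) else ω.1 x

/-- The non-isolated part of `A` agrees with `ω` in the window off `Λ`. -/
def Fits (Λ : Finset ℤ) (L R : ℤ) (ω : NonIso) (A : Finset ℤ) : Prop :=
  ∀ x ∈ Icc L R, x ∉ Λ → (x ∈ nonIsolated A ↔ ω.1 x = 1)

theorem glue_eq_one_of_mem {A : Finset ℤ} {x : ℤ} (hx : x ∈ Icc L R) :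
    glue L R ω A x = 1 ↔ x ∈ nonIsolated A := by
  simp only [glue, if_pos hx]
  split_ifs with h <;> simp [h]

theorem glue_of_notMem {A : Finset ℤ} {x : ℤ} (hx : x ∉ Icc L R) :
    glue L R ω A x = ω.1 x := by
  simp only [glue, if_neg hx]

/-- A neighbour in `A` of a non-isolated point of `A` is itself non-isolated. An occupied site
outside the window can meet the window only at an end, which is off `Λ`, so that `Fits` forces the
value of `ω` there. -/
theorem IsWindow.glue_mem (hw : IsWindow Λ L R ω) {A : Finset ℤ} (hA : A ⊆ Icc L R)
    (hf : Fits Λ L R ω A) : glue L R ω A ∈ Set.range thin := by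
  rw [mem_range_thin]
  intro x hx
  by_cases hxI : x ∈ Icc L R
  · rw [glue_eq_one_of_mem hxI, mem_nonIsolated] at hx
    refine hx.2.imp (fun h => ?_) fun h => ?_
    · rw [glue_eq_one_of_mem (hA h), mem_nonIsolated, sub_add_cancel]
      exact ⟨h, Or.inr hx.1⟩
    · rw [glue_eq_one_of_mem (hA h), mem_nonIsolated, add_sub_cancel_right]
      exact ⟨h, Or.inl hx.1⟩
  · rw [glue_of_notMem hxI] at hx
    rw [mem_Icc] at hxI
    have key : ∀ y, ω.1 y = 1 → (y = x - 1 ∨ y = x + 1) → glue L R ω A y = 1 := by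
      intro y hy hxy
      by_cases hyI : y ∈ Icc L R
      · rw [glue_eq_one_of_mem hyI]
        refine (hf y hyI ?_).2 hy
        rw [mem_Icc] at hyI
        by_cases h : y ≤ L + 1
        · exact hw.notMem_of_le h
        · exact hw.notMem_of_ge (by omega)
      · rwa [glue_of_notMem hyI]
    exact (ω.neighbour hx).imp (fun h => key _ h (Or.inl rfl)) fun h => key _ h (Or.inr rfl)

open Classical in
/-- The total weight of the configurations in the window whose non-isolated part fits to `ω₀` off
`Λ`, and belongs to `B` when continued by `ω`. -/
noncomputable def gluedSum (p : ℝ) (Λ : Finset ℤ) (L R : ℤ) (ω₀ ω : NonIso) (B : Set Config) : ℝ :=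
  ∑ A ∈ (Icc L R).powerset with Fits Λ L R ω₀ A,
    siteWeight (activity p L R ω₀) (1 - p) (Icc L R) A * B.indicator 1 (glue L R ω A)

open Classical in
-- Each fitting `A` belongs to the fibre of exactly one `η`, namely its `glue`. Both sides sum over
-- the same pairs `(η, A)`.
theorem IsWindow.sum_windowWeight (hw : IsWindow Λ L R ω) (B : Set Config) :
    ∑ η ∈ (sameOff_finite Λ ω).toFinset, windowWeight p L R η * B.indicator 1 η.1 =
      gluedSum p Λ L R ω ω B := by
  have h1 : ∀ A ∈ (Icc L R).powerset.filter (Fits Λ L R ω),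
      siteWeight (activity p L R ω) (1 - p) (Icc L R) A * B.indicator 1 (glue L R ω A) =
      ∑ η ∈ (sameOff_finite Λ ω).toFinset with nonIsolated A = occupiedIn L R η,
        siteWeight (activity p L R ω) (1 - p) (Icc L R) A * B.indicator 1 η.1 := by
    intro A hA
    rw [mem_filter, mem_powerset] at hA
    have h2 : (sameOff_finite Λ ω).toFinset.filter (fun η => nonIsolated A = occupiedIn L R η) =
        {⟨glue L R ω A, hw.glue_mem hA.1 hA.2⟩} := by
      ext η
      simp only [mem_filter, Set.Finite.mem_toFinset, mem_singleton]
      constructor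
      · rintro ⟨hη, h⟩
        refine Subtype.ext (ext_of_eq_one fun x => ?_)
        change η.1 x = 1 ↔ glue L R ω A x = 1
        by_cases hx : x ∈ Icc L R
        · rw [glue_eq_one_of_mem hx, h, mem_occupiedIn, ← mem_Icc]
          simp [hx]
        · rw [glue_of_notMem hx, hη x]
          intro h
          have := hw.subset x h
          rw [mem_Icc] at hx
          omega
      · rintro rfl
        refine ⟨fun x hx => ?_, ?_⟩
        · by_cases hxI : x ∈ Icc L R
          · have := hA.2 x hxI hx
            rw [← glue_eq_one_of_mem (ω := ω) hxI] at this
            exact eq_of_eq_one_iff this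
          · exact glue_of_notMem hxI
        · ext x
          rw [mem_occupiedIn, ← mem_Icc]
          constructor
          · intro h
            have hx : x ∈ Icc L R := hA.1 (mem_nonIsolated.1 h).1
            exact ⟨hx, (glue_eq_one_of_mem hx).2 h⟩
          · rintro ⟨hx, h⟩
            exact (glue_eq_one_of_mem hx).1 h
    rw [h2, Finset.sum_singleton]
  rw [gluedSum, Finset.sum_congr rfl h1]
  simp only [windowWeight, Finset.sum_mul]
  rw [Finset.sum_congr rfl fun η hη => by
    rw [activity_congr hw ((Set.Finite.mem_toFinset _).1 hη)]]
  refine Finset.sum_comm' fun η A => ?_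
  simp only [mem_filter, Set.Finite.mem_toFinset]
  constructor
  · rintro ⟨hη, hA, h⟩
    refine ⟨⟨hη, h⟩, hA, fun x hx hxΛ => ?_⟩
    rw [h, mem_occupiedIn, ← mem_Icc, hη x hxΛ]
    simp [hx]
  · rintro ⟨⟨hη, h⟩, hA, -⟩
    exact ⟨hη, hA, h⟩

end Glue

/-! ### The kernels as conditioned product measures; consistency. -/

section Kernel

variable {p : ℝ} {Λ Δ : Finset ℤ} {L R : ℤ} {ω η ξ : NonIso}

theorem self_mem_sameOff (Λ : Finset ℤ) (ω : NonIso) : ω ∈ sameOff Λ ω := fun _ _ => rfl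

theorem sameOff_eq (hη : η ∈ sameOff Λ ω) : sameOff Λ η = sameOff Λ ω := by
  ext ξ
  exact ⟨fun h i hi => (h i hi).trans (hη i hi), fun h i hi => (h i hi).trans (hη i hi).symm⟩

theorem sameOff_toFinset_eq (hη : η ∈ sameOff Λ ω) :
    (sameOff_finite Λ η).toFinset = (sameOff_finite Λ ω).toFinset := by
  ext ξ
  simp only [Set.Finite.mem_toFinset, sameOff_eq hη]

theorem partitionFunction_congr (hη : η ∈ sameOff Λ ω) :
    partitionFunction p Λ η = partitionFunction p Λ ω := by
  rw [partitionFunction, sameOff_toFinset_eq hη, partitionFunction]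

theorem partitionFunction_pos (hp : p ∈ Set.Ioo (0 : ℝ) 1) (Λ : Finset ℤ) (ω : NonIso) :
    0 < partitionFunction p Λ ω :=
  Finset.sum_pos (fun η _ => weight_pos hp _ η)
    ⟨ω, (Set.Finite.mem_toFinset _).2 (self_mem_sameOff Λ ω)⟩

theorem thinnedSpec_apply (hp : p ∈ Set.Ioo (0 : ℝ) 1) (Λ : Finset ℤ) (ω : NonIso)
    (A : Set NonIso) :
    thinnedSpec p Λ ω A = ENNReal.ofReal
      (∑ η ∈ (sameOff_finite Λ ω).toFinset,
        weight p Λ η / partitionFunction p Λ ω * A.indicator 1 η) := by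
  have h0 : ∀ η, 0 ≤ weight p Λ η / partitionFunction p Λ ω := fun η =>
    (div_pos (weight_pos hp _ η) (partitionFunction_pos hp Λ ω)).le
  rw [thinnedSpec, Measure.finsetSum_apply, ENNReal.ofReal_sum_of_nonneg]
  · refine Finset.sum_congr rfl fun η _ => ?_
    rw [Measure.smul_apply, Measure.dirac_apply, smul_eq_mul, ENNReal.ofReal_mul (h0 η)]
    by_cases h : η ∈ A <;> simp [h]
  · exact fun η _ => mul_nonneg (h0 η) (Set.indicator_nonneg (fun _ _ => zero_le_one) _)

theorem thinnedSpec_univ (hp : p ∈ Set.Ioo (0 : ℝ) 1) (Λ : Finset ℤ) (ω : NonIso) :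
    thinnedSpec p Λ ω Set.univ = 1 := by
  rw [thinnedSpec_apply hp]
  simp only [Set.indicator_univ, Pi.one_apply, mul_one]
  rw [← Finset.sum_div, ← partitionFunction, div_self (partitionFunction_pos hp Λ ω).ne',
    ENNReal.ofReal_one]

theorem isProbabilityMeasure_thinnedSpec (hp : p ∈ Set.Ioo (0 : ℝ) 1) (Λ : Finset ℤ)
    (ω : NonIso) : IsProbabilityMeasure (thinnedSpec p Λ ω) :=
  ⟨thinnedSpec_univ hp Λ ω⟩

/-- All configurations charged by the kernel agree with `ω` off `Λ`, so `B` contains all of them or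
none. Taking `A` to be everything gives properness. -/
theorem thinnedSpec_inter (hp : p ∈ Set.Ioo (0 : ℝ) 1) (Λ : Finset ℤ) (A : Set NonIso)
    {B : Set NonIso} (hB : MeasurableSet[eventsIn (Λ : Set ℤ)ᶜ] B) (ω : NonIso) :
    thinnedSpec p Λ ω (A ∩ B) = B.indicator (fun ω => thinnedSpec p Λ ω A) ω := by
  have h : ∀ η ∈ (sameOff_finite Λ ω).toFinset, (η ∈ B ↔ ω ∈ B) := fun η hη =>
    mem_congr_of_eventsIn hB fun x hx => (Set.Finite.mem_toFinset _).1 hη x fun h => hx h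
  by_cases hω : ω ∈ B
  · rw [Set.indicator_of_mem hω, thinnedSpec_apply hp, thinnedSpec_apply hp]
    congr 1
    refine Finset.sum_congr rfl fun η hη => ?_
    have hηB := (h η hη).2 hω
    by_cases hA : η ∈ A <;> simp [hA, hηB]
  · rw [Set.indicator_of_notMem hω, thinnedSpec_apply hp, Finset.sum_eq_zero, ENNReal.ofReal_zero]
    intro η hη
    rw [Set.indicator_of_notMem, mul_zero]
    exact fun H => hω ((h η hη).1 H.2)

/-- The constant of proportionality between `weight` and `windowWeight` cancels on normalisation. -/
theorem IsWindow.thinnedSpec_preimage (hp : p ∈ Set.Ioo (0 : ℝ) 1) (hw : IsWindow Λ L R ω)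
    (B : Set Config) :
    thinnedSpec p Λ ω (Subtype.val ⁻¹' B) =
      ENNReal.ofReal (gluedSum p Λ L R ω ω B / gluedSum p Λ L R ω ω Set.univ) := by
  rw [thinnedSpec_apply hp, ← hw.sum_windowWeight, ← hw.sum_windowWeight]
  have h1 := weight_pos hp Λ ω
  have h2 := windowWeight_pos hp hw
  have h3 : ∀ η ∈ (sameOff_finite Λ ω).toFinset,
      windowWeight p L R η = windowWeight p L R ω / weight p Λ ω * weight p Λ η := by
    intro η hη
    have := hw.weight_mul_windowWeight hp ((Set.Finite.mem_toFinset _).1 hη)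
    field_simp
    linear_combination -this
  have h4 : ∑ η ∈ (sameOff_finite Λ ω).toFinset,
      windowWeight p L R η * Set.univ.indicator 1 η.1 =
      windowWeight p L R ω / weight p Λ ω * partitionFunction p Λ ω := by
    rw [partitionFunction, Finset.mul_sum]
    refine Finset.sum_congr rfl fun η hη => ?_
    rw [h3 η hη]
    simp
  have h5 := partitionFunction_pos hp Λ ω
  rw [h4, Finset.sum_div]
  congr 1
  refine Finset.sum_congr rfl fun η hη => ?_
  have h6 : (Subtype.val ⁻¹' B : Set NonIso).indicator (1 : NonIso → ℝ) η =
      B.indicator 1 η.1 := rfl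
  rw [h3 η hη, h6]
  field_simp

theorem IsWindow.gluedSum_univ_pos (hp : p ∈ Set.Ioo (0 : ℝ) 1) (hw : IsWindow Λ L R ω) :
    0 < gluedSum p Λ L R ω ω Set.univ := by
  rw [← hw.sum_windowWeight]
  refine Finset.sum_pos (fun η hη => ?_)
    ⟨ω, (Set.Finite.mem_toFinset _).2 (self_mem_sameOff Λ ω)⟩
  have := windowWeight_pos hp (hw.congr ((Set.Finite.mem_toFinset _).1 hη))
  simpa using this

theorem lintegral_thinnedSpec (Λ : Finset ℤ) (ω : NonIso) (f : NonIso → ENNReal) :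
    ∫⁻ ξ, f ξ ∂(thinnedSpec p Λ ω) = ∑ η ∈ (sameOff_finite Λ ω).toFinset,
      ENNReal.ofReal (weight p Λ η / partitionFunction p Λ ω) * f η := by
  rw [thinnedSpec, lintegral_finsetSum_measure]
  refine Finset.sum_congr rfl fun η _ => ?_
  rw [lintegral_smul_measure, lintegral_dirac, smul_eq_mul]

/-- After exchanging the sums, `weight_mul_weight` swaps the windows in the product of the two
weights; the inner sum over `ξ` then cancels the partition function of `Λ`. -/
theorem thinnedSpec_consistent (hp : p ∈ Set.Ioo (0 : ℝ) 1) (hΛ : Λ ⊆ Δ) (A : Set NonIso)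
    (ω : NonIso) : ∫⁻ ξ, thinnedSpec p Λ ξ A ∂(thinnedSpec p Δ ω) = thinnedSpec p Δ ω A := by
  have h0 : ∀ (Δ : Finset ℤ) (ω η : NonIso), 0 ≤ weight p Δ η / partitionFunction p Δ ω :=
    fun Δ ω η => (div_pos (weight_pos hp _ η) (partitionFunction_pos hp Δ ω)).le
  have h1 : ∀ (Δ : Finset ℤ) (ω : NonIso), 0 ≤ ∑ η ∈ (sameOff_finite Δ ω).toFinset,
      weight p Δ η / partitionFunction p Δ ω * A.indicator 1 η := fun Δ ω =>
    Finset.sum_nonneg fun η _ =>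
      mul_nonneg (h0 Δ ω η) (Set.indicator_nonneg (fun _ _ => zero_le_one) _)
  rw [lintegral_thinnedSpec]
  simp only [thinnedSpec_apply hp]
  rw [Finset.sum_congr rfl fun ξ _ => (ENNReal.ofReal_mul (h0 Δ ω ξ)).symm,
    ← ENNReal.ofReal_sum_of_nonneg fun ξ _ => mul_nonneg (h0 Δ ω ξ) (h1 Λ ξ)]
  congr 1
  simp only [Finset.mul_sum]
  rw [Finset.sum_comm' (s' := fun η => (sameOff_finite Λ η).toFinset)
    (t' := (sameOff_finite Δ ω).toFinset)]
  · refine Finset.sum_congr rfl fun η _ => ?_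
    have h2 : ∀ ξ ∈ (sameOff_finite Λ η).toFinset,
        weight p Δ ξ / partitionFunction p Δ ω *
          (weight p Λ η / partitionFunction p Λ ξ * A.indicator 1 η) =
        weight p Λ ξ * (weight p Δ η / partitionFunction p Δ ω * A.indicator 1 η /
          partitionFunction p Λ η) := by
      intro ξ hξ
      have hξ := (Set.Finite.mem_toFinset _).1 hξ
      have h3 := weight_mul_weight hp hΛ hξ
      rw [partitionFunction_congr hξ]
      have h4 := (partitionFunction_pos hp Λ η).ne'
      have h5 := (partitionFunction_pos hp Δ ω).ne'
      field_simp
      linear_combination A.indicator 1 η * h3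
    rw [Finset.sum_congr rfl h2, ← Finset.sum_mul, ← partitionFunction]
    have h4 := (partitionFunction_pos hp Λ η).ne'
    field_simp
  · intro ξ η
    simp only [Set.Finite.mem_toFinset]
    constructor
    · rintro ⟨h2, h3⟩
      exact ⟨sameOff_comm h3, by
        rw [← sameOff_eq h2]; exact sameOff_mono hΛ h3⟩
    · rintro ⟨h2, h3⟩
      exact ⟨by rw [← sameOff_eq h3]; exact sameOff_mono hΛ h2, sameOff_comm h2⟩

end Kernel

/-! ### Measurability in the boundary condition. -/

section Measurability

variable {p : ℝ} {Λ : Finset ℤ} {L R : ℤ} {ω ω₀ ω₁ : NonIso} {B : Set Config}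

/-- `Fits` reads the configuration off `Λ` only, and the activities read it only at `L` and `R`. -/
theorem gluedSum_congr_left (hL : L ∉ Λ) (hR : R ∉ Λ) (hLR : L ≤ R)
    (h : ∀ x ∈ Icc L R, x ∉ Λ → ω₀.1 x = ω₁.1 x) :
    gluedSum p Λ L R ω₀ ω B = gluedSum p Λ L R ω₁ ω B := by
  classical
  have h1 : Fits Λ L R ω₀ = Fits Λ L R ω₁ := by
    funext A
    refine propext (forall₃_congr fun x hx hxΛ => ?_)
    rw [h x hx hxΛ]
  have h2 : activity p L R ω₀ = activity p L R ω₁ := by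
    funext x
    unfold activity
    by_cases hx : x = L ∨ x = R
    · rw [h x]
      · rw [mem_Icc]; omega
      · rcases hx with rfl | rfl <;> assumption
    · simp [hx]
  unfold gluedSum
  simp only [h1, h2]

theorem gluedSum_congr_right {ω' : NonIso}
    (h : ∀ A : Finset ℤ, glue L R ω A ∈ B ↔ glue L R ω' A ∈ B) :
    gluedSum p Λ L R ω₀ ω B = gluedSum p Λ L R ω₀ ω' B := by
  classical
  refine Finset.sum_congr rfl fun A _ => ?_
  congr 1
  by_cases hA : glue L R ω A ∈ B
  · rw [Set.indicator_of_mem hA, Set.indicator_of_mem ((h A).1 hA)]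
    rfl
  · rw [Set.indicator_of_notMem hA, Set.indicator_of_notMem fun H => hA ((h A).2 H)]

theorem measurable_glue (hΛ : Λ ⊆ Icc L R) (A : Finset ℤ) :
    Measurable[eventsIn (Λ : Set ℤ)ᶜ] fun ω => glue L R ω A := by
  rw [@measurable_pi_iff]
  intro x
  by_cases hx : x ∈ Icc L R
  · simp only [glue, if_pos hx]
    exact @measurable_const _ _ _ _ _
  · simp only [glue, if_neg hx]
    exact measurable_apply_eventsIn fun h => hx (hΛ h)

theorem measurable_gluedSum (hΛ : Λ ⊆ Icc L R) (ω₀ : NonIso) (hB : MeasurableSet B) :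
    Measurable[eventsIn (Λ : Set ℤ)ᶜ] fun ω => gluedSum p Λ L R ω₀ ω B := by
  unfold gluedSum
  refine Finset.measurable_sum _ fun A _ => ?_
  refine Measurable.const_mul ?_ _
  exact (measurable_one.indicator hB).comp (measurable_glue hΛ A)

theorem IsWindow.subset_Icc (hw : IsWindow Λ L R ω) : Λ ⊆ Icc L R := fun x hx => by
  have := hw.subset x hx
  rw [mem_Icc]
  omega

theorem measurableSet_isWindow (Λ : Finset ℤ) (L R : ℤ) (T : Finset ℤ) :
    MeasurableSet[eventsIn (Λ : Set ℤ)ᶜ] {ω : NonIso | IsWindow Λ L R ω ∧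
      ∀ x ∈ Icc L R, x ∉ Λ → (ω.1 x = 1 ↔ x ∈ T)} := by
  by_cases h0 : L < R ∧ ∀ x ∈ Λ, L + 2 ≤ x ∧ x + 2 ≤ R
  · obtain ⟨hlt, hsub⟩ := h0
    have hl : ∀ x ≤ L + 1, x ∈ (Λ : Set ℤ)ᶜ := fun x hx h => by have := hsub x h; omega
    have hr : ∀ x, R - 1 ≤ x → x ∈ (Λ : Set ℤ)ᶜ := fun x hx h => by have := hsub x h; omega
    have e : {ω : NonIso | IsWindow Λ L R ω ∧
        ∀ x ∈ Icc L R, x ∉ Λ → (ω.1 x = 1 ↔ x ∈ T)} =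
        ((({ω | ω.1 L = 1} ∩ {ω | ω.1 (L + 1) = 1}) ∪ ⋂ x ∈ Set.Iic (L + 1), {ω | ω.1 x = 1}ᶜ) ∩
        (({ω | ω.1 R = 1} ∩ {ω | ω.1 (R - 1) = 1}) ∪ ⋂ x ∈ Set.Ici (R - 1), {ω | ω.1 x = 1}ᶜ)) ∩
        ⋂ x ∈ {x | x ∈ Icc L R ∧ x ∉ Λ}, {ω | ω.1 x = 1 ↔ x ∈ T} := by
      ext ω
      simp only [Set.mem_ofPred_eq, Set.mem_inter_iff, Set.mem_union, Set.mem_iInter,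
        Set.mem_compl_iff, Set.mem_Iic, Set.mem_Ici, and_imp]
      exact and_congr_left fun _ =>
        ⟨fun h => ⟨h.left, h.right⟩, fun h => ⟨hlt, hsub, h.1, h.2⟩⟩
    rw [e]
    refine MeasurableSet.inter (MeasurableSet.inter (MeasurableSet.union (MeasurableSet.inter ?_ ?_)
      ?_) (MeasurableSet.union (MeasurableSet.inter ?_ ?_) ?_)) ?_
    · exact measurableSet_eventsIn_apply (hl _ (by omega))
    · exact measurableSet_eventsIn_apply (hl _ le_rfl)
    · exact MeasurableSet.biInter (Set.to_countable _) fun x hx =>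
        (measurableSet_eventsIn_apply (hl x hx)).compl
    · exact measurableSet_eventsIn_apply (hr _ (by omega))
    · exact measurableSet_eventsIn_apply (hr _ le_rfl)
    · exact MeasurableSet.biInter (Set.to_countable _) fun x hx =>
        (measurableSet_eventsIn_apply (hr x hx)).compl
    · refine MeasurableSet.biInter (Set.to_countable _) fun x hx => ?_
      have h1 := measurableSet_eventsIn_apply (Δ := (Λ : Set ℤ)ᶜ) (x := x) hx.2
      by_cases hT : x ∈ T
      · simpa only [hT, iff_true] using h1
      · simp only [hT, iff_false]
        exact h1.compl
  · convert @MeasurableSet.empty _ (eventsIn (Λ : Set ℤ)ᶜ)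
    refine Set.eq_empty_of_forall_notMem fun ω hω => h0 ⟨hω.1.lt, hω.1.subset⟩

/-- The window varies with `ω`, but there are countably many triples of ends and occupied set off
`Λ`. On the event of each triple the kernel is a ratio of finite sums that depend on `ω` only
through the spins outside the window. -/
theorem measurable_thinnedSpec (hp : p ∈ Set.Ioo (0 : ℝ) 1) (Λ : Finset ℤ) {A : Set NonIso}
    (hA : MeasurableSet A) :
    Measurable[eventsIn (Λ : Set ℤ)ᶜ] fun ω => thinnedSpec p Λ ω A := by
  classical
  obtain ⟨B, hB, rfl⟩ := hA
  intro S hS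
  let G : ℤ × ℤ × Finset ℤ → Set NonIso := fun i => {ω | IsWindow Λ i.1 i.2.1 ω ∧
    ∀ x ∈ Icc i.1 i.2.1, x ∉ Λ → (ω.1 x = 1 ↔ x ∈ i.2.2)}
  have e : (fun ω => thinnedSpec p Λ ω (Subtype.val ⁻¹' B)) ⁻¹' S =
      ⋃ i, (G i ∩ (fun ω => thinnedSpec p Λ ω (Subtype.val ⁻¹' B)) ⁻¹' S) := by
    rw [← Set.iUnion_inter]
    refine (Set.inter_eq_right.2 fun ω _ => ?_).symm
    obtain ⟨L, R, hw⟩ := exists_isWindow Λ ω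
    refine Set.mem_iUnion.2 ⟨(L, R, occupiedIn L R ω), hw, fun x hx _ => ?_⟩
    simp only [mem_occupiedIn, ← mem_Icc]
    simp only [hx, true_and]
  rw [e]
  refine MeasurableSet.iUnion fun i => ?_
  obtain ⟨L, R, T⟩ := i
  rcases (G (L, R, T)).eq_empty_or_nonempty with h | ⟨ω₀, hω₀⟩
  · rw [h, Set.empty_inter]
    exact @MeasurableSet.empty _ (eventsIn (Λ : Set ℤ)ᶜ)
  · have hsub := hω₀.1.subset_Icc
    have hg : Measurable[eventsIn (Λ : Set ℤ)ᶜ] fun ω => ENNReal.ofReal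
        (gluedSum p Λ L R ω₀ ω B / gluedSum p Λ L R ω₀ ω Set.univ) :=
      ((measurable_gluedSum hsub ω₀ hB).div
        (measurable_gluedSum hsub ω₀ MeasurableSet.univ)).ennreal_ofReal
    have e2 : G (L, R, T) ∩ (fun ω => thinnedSpec p Λ ω (Subtype.val ⁻¹' B)) ⁻¹' S =
        G (L, R, T) ∩ (fun ω => ENNReal.ofReal
        (gluedSum p Λ L R ω₀ ω B / gluedSum p Λ L R ω₀ ω Set.univ)) ⁻¹' S := by
      ext ω
      refine and_congr_right fun hω => ?_
      have hw : IsWindow Λ L R ω := hω.1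
      have h1 : ∀ B, gluedSum p Λ L R ω ω B = gluedSum p Λ L R ω₀ ω B := fun B =>
        gluedSum_congr_left (hw.notMem_of_le (by omega)) (hw.notMem_of_ge (by omega)) hw.lt.le
          fun x hx hxΛ => by
            have h2 := hω.2 x hx hxΛ
            have h3 := hω₀.2 x hx hxΛ
            exact eq_of_eq_one_iff (h2.trans h3.symm)
      simp only [Set.mem_preimage]
      rw [hw.thinnedSpec_preimage hp, h1, h1]
    rw [e2]
    exact (measurableSet_isWindow Λ L R T).inter (hg hS)

theorem isSpecification_thinnedSpec (hp : p ∈ Set.Ioo (0 : ℝ) 1) :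
    IsSpecification (thinnedSpec p) where
  isProbabilityMeasure := isProbabilityMeasure_thinnedSpec hp
  measurable Λ A hA := measurable_thinnedSpec hp Λ hA
  proper Λ A hA ω := by
    have := thinnedSpec_inter hp Λ Set.univ hA ω
    rw [Set.univ_inter] at this
    rw [this]
    simp only [thinnedSpec_univ hp]
    rfl
  consistent Λ Δ h A _ ω := thinnedSpec_consistent hp h A ω

end Measurability

open scoped ENNReal

/-! ### The Bernoulli field on local events, and almost sure occupied bonds. -/

section Bernoulli

/-- The configuration with occupied set `A`. -/
def ofOccupied (A : Finset ℤ) : Config := fun x => if x ∈ A then 1 else 0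

theorem ofOccupied_eq_one {A : Finset ℤ} {x : ℤ} : ofOccupied A x = 1 ↔ x ∈ A := by
  unfold ofOccupied
  split_ifs with h <;> simp [h]

theorem thin_ofOccupied {A : Finset ℤ} {x : ℤ} : thin (ofOccupied A) x = 1 ↔ x ∈ nonIsolated A := by
  rw [thin_eq_one, mem_nonIsolated, ofOccupied_eq_one, ofOccupied_eq_one, ofOccupied_eq_one]

theorem measurable_thin : Measurable thin := by
  rw [measurable_pi_iff]
  intro x
  have : Measurable fun a : Fin 2 × Fin 2 × Fin 2 => a.1 * (1 - (1 - a.2.1) * (1 - a.2.2)) :=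
    measurable_of_finite _
  exact this.comp (g := fun a : Fin 2 × Fin 2 × Fin 2 => a.1 * (1 - (1 - a.2.1) * (1 - a.2.2)))
    (f := fun ω : Config => (ω x, ω (x - 1), ω (x + 1))) ((measurable_pi_apply x).prodMk
    ((measurable_pi_apply (x - 1)).prodMk (measurable_pi_apply (x + 1))))

theorem measurable_toNonIso : Measurable toNonIso := measurable_thin.subtype_mk

variable (p : unitInterval)

instance : IsProbabilityMeasure (bernoulliField p) := by
  unfold bernoulliField
  infer_instance

instance : IsProbabilityMeasure (thinnedField p) :=
  Measure.isProbabilityMeasure_map measurable_toNonIso.aemeasurable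

theorem bernoulliField_pi (J : Finset ℤ) (c : Config) :
    bernoulliField p {ω | ∀ x ∈ J, ω x = c x} =
      ENNReal.ofReal (∏ x ∈ J, if c x = 1 then (p : ℝ) else 1 - p) := by
  have e : {ω : Config | ∀ x ∈ J, ω x = c x} = Set.pi J fun x => {c x} := by
    ext ω
    simp [Set.mem_pi]
  rw [e, bernoulliField, Measure.infinitePi_pi _ fun x _ => measurableSet_singleton _,
    ENNReal.ofReal_prod_of_nonneg]
  · refine Finset.prod_congr rfl fun x _ => ?_
    rw [← ofReal_measureReal, ProbabilityTheory.bernoulliMeasure_real_apply _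
      (measurableSet_singleton _)]
    congr 1
    have : ∀ a : Fin 2, a = 0 ∨ a = 1 := by decide
    rcases this (c x) with h | h <;> simp [h]
  · intro x _
    have := p.2
    split_ifs <;> linarith [this.1, this.2]

theorem bernoulliField_atom {J A : Finset ℤ} (hA : A ⊆ J) :
    bernoulliField p {ω | ∀ x ∈ J, ω x = ofOccupied A x} =
      ENNReal.ofReal (siteWeight (fun _ => (p : ℝ)) (1 - p) J A) := by
  rw [bernoulliField_pi]
  congr 1
  simp only [ofOccupied_eq_one]
  rw [Finset.prod_ite, siteWeight, Finset.prod_const, Finset.prod_const, Finset.prod_const]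
  congr 2
  · rw [Finset.filter_mem_eq_inter, inter_eq_right.2 hA]
  · rw [Finset.filter_notMem_eq_sdiff]

/-- The probability of an event that depends on the spins in `J`, as a finite sum. -/
noncomputable def bernoulliSum (J : Finset ℤ) (B : Set Config) : ℝ :=
  ∑ A ∈ J.powerset, siteWeight (fun _ => (p : ℝ)) (1 - p) J A * B.indicator 1 (ofOccupied A)

theorem bernoulliField_eq_bernoulliSum {J : Finset ℤ} {B : Set Config}
    (hB : ∀ ω η : Config, (∀ x ∈ J, ω x = η x) → (ω ∈ B ↔ η ∈ B)) :
    bernoulliField p B = ENNReal.ofReal (bernoulliSum p J B) := by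
  classical
  have hms : ∀ A : Finset ℤ, MeasurableSet {ω : Config | ∀ x ∈ J, ω x = ofOccupied A x} := by
    intro A
    have e : {ω : Config | ∀ x ∈ J, ω x = ofOccupied A x} = Set.pi J fun x => {ofOccupied A x} := by
      ext ω
      simp [Set.mem_pi]
    rw [e]
    exact MeasurableSet.pi J.countable_toSet fun x _ => measurableSet_singleton _
  have e1 : B = ⋃ A ∈ J.powerset, ({ω : Config | ∀ x ∈ J, ω x = ofOccupied A x} ∩ B) := by
    ext ω
    simp only [Set.mem_iUnion, Set.mem_inter_iff, Set.mem_ofPred_eq, exists_prop, mem_powerset]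
    constructor
    · intro h
      refine ⟨J.filter fun x => ω x = 1, filter_subset _ _, fun x hx => ?_, h⟩
      refine eq_of_eq_one_iff ?_
      rw [ofOccupied_eq_one, mem_filter]
      simp [hx]
    · rintro ⟨A, -, -, h⟩
      exact h
  have e2 : ∀ A, {ω : Config | ∀ x ∈ J, ω x = ofOccupied A x} ∩ B =
      if ofOccupied A ∈ B then {ω : Config | ∀ x ∈ J, ω x = ofOccupied A x} else ∅ := by
    intro A
    split_ifs with h
    · exact Set.inter_eq_left.2 fun ω hω => (hB ω _ hω).2 h
    · exact Set.eq_empty_of_forall_notMem fun ω hω => h ((hB ω _ hω.1).1 hω.2)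
  have h0 : ∀ A, 0 ≤ siteWeight (fun _ => (p : ℝ)) (1 - p) J A := fun A =>
    mul_nonneg (Finset.prod_nonneg fun _ _ => p.2.1) (pow_nonneg (by linarith [p.2.2]) _)
  rw [e1, measure_biUnion_finset, bernoulliSum, ENNReal.ofReal_sum_of_nonneg]
  · rw [← e1]
    refine Finset.sum_congr rfl fun A hA => ?_
    rw [e2]
    split_ifs with h
    · rw [bernoulliField_atom p (mem_powerset.1 hA), Set.indicator_of_mem h]
      simp
    · rw [Set.indicator_of_notMem h]
      simp
  · rw [← e1]
    exact fun A _ => mul_nonneg (h0 A) (Set.indicator_nonneg (fun _ _ => zero_le_one) _)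
  · intro A hA A' hA' hne
    refine Set.disjoint_left.2 fun ω hω hω' => hne ?_
    rw [mem_coe, mem_powerset] at hA hA'
    ext x
    by_cases hx : x ∈ J
    · rw [← ofOccupied_eq_one, ← hω.1 x hx, hω'.1 x hx, ofOccupied_eq_one]
    · exact ⟨fun h => absurd (hA h) hx, fun h => absurd (hA' h) hx⟩
  · intro A _
    rw [e2]
    split_ifs
    · exact hms A
    · exact MeasurableSet.empty

theorem bernoulliSum_univ (J : Finset ℤ) : bernoulliSum p J Set.univ = 1 := by
  have := bernoulliField_eq_bernoulliSum p (J := J) (B := Set.univ) (by simp)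
  rw [measure_univ] at this
  exact (ENNReal.ofReal_eq_one.1 this.symm)

theorem thin_congr {ω η : Config} {a b : ℤ} (h : ∀ x ∈ Icc (a - 1) (b + 1), ω x = η x) :
    ∀ x ∈ Icc a b, thin ω x = thin η x := by
  intro x hx
  rw [mem_Icc] at hx
  unfold thin
  rw [h x (by rw [mem_Icc]; omega), h (x - 1) (by rw [mem_Icc]; omega),
    h (x + 1) (by rw [mem_Icc]; omega)]

/-- The window grows by one site on each side because thinning reads nearest neighbours. -/
theorem thinnedField_eq_bernoulliSum {a b : ℤ} {B : Set Config}
    (hB : MeasurableSet[cylinderEvents (X := fun _ : ℤ => Fin 2) (Icc a b : Finset ℤ)] B) :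
    thinnedField p (Subtype.val ⁻¹' B) =
      ENNReal.ofReal (bernoulliSum p (Icc (a - 1) (b + 1)) (thin ⁻¹' B)) := by
  rw [thinnedField, Measure.map_apply measurable_toNonIso ⟨B, cylinderEvents_le_pi _ hB, rfl⟩]
  exact bernoulliField_eq_bernoulliSum p (B := thin ⁻¹' B) fun ω η h =>
    mem_congr_of_cylinderEvents hB fun x hx => thin_congr h x (mem_coe.1 hx)

/-- Occupied bonds occur almost surely in every sequence of disjoint bonds. -/
theorem ae_exists_bond (hp : 0 < (p : ℝ)) {u : ℕ → ℤ}
    (hu : ∀ i j, i ≠ j → u i ≠ u j ∧ u i ≠ u j + 1) :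
    ∀ᵐ ω ∂(bernoulliField p), ∃ j, ω (u j) = 1 ∧ ω (u j + 1) = 1 := by
  classical
  let s : ℕ → Set Config := fun j => {ω | ω (u j) = 1 ∧ ω (u j + 1) = 1}
  have hT : ∀ T : Finset ℤ, bernoulliField p {ω | ∀ x ∈ T, ω x = 1} =
      ENNReal.ofReal p ^ T.card := by
    intro T
    have := bernoulliField_pi p T fun _ => 1
    simp only [if_true, Finset.prod_const] at this
    rw [this, ENNReal.ofReal_pow hp.le]
  have hs : ∀ K : Finset ℕ, (⋂ j ∈ K, s j) =
      {ω | ∀ x ∈ K.biUnion fun j => {u j, u j + 1}, ω x = 1} := by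
    intro K
    ext ω
    simp only [Set.mem_iInter, Set.mem_ofPred_eq, mem_biUnion, mem_insert, mem_singleton, s]
    constructor
    · rintro h x ⟨j, hj, rfl | rfl⟩
      · exact (h j hj).1
      · exact (h j hj).2
    · exact fun h j hj => ⟨h _ ⟨j, hj, Or.inl rfl⟩, h _ ⟨j, hj, Or.inr rfl⟩⟩
  have hK : ∀ K : Finset ℕ, bernoulliField p (⋂ j ∈ K, s j) =
      ∏ _j ∈ K, ENNReal.ofReal p ^ 2 := by
    intro K
    rw [hs, hT, Finset.card_biUnion, Finset.prod_const, ← pow_mul]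
    · congr 1
      rw [Finset.sum_congr rfl fun j _ => Finset.card_pair (by omega : u j ≠ u j + 1)]
      simp [mul_comm]
    · intro i _ j _ hij
      rw [Function.onFun, Finset.disjoint_left]
      have h1 := hu i j hij
      have h2 := hu j i hij.symm
      simp only [mem_insert, mem_singleton]
      omega
  have h1 : ∀ j, bernoulliField p (s j) = ENNReal.ofReal p ^ 2 := fun j => by
    simpa using hK {j}
  have hsm : ∀ j, MeasurableSet (s j) := fun j =>
    (measurableSet_eq_fun (measurable_pi_apply (u j)) measurable_const).inter
      (measurableSet_eq_fun (measurable_pi_apply (u j + 1)) measurable_const)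
  have hind : ProbabilityTheory.iIndepSet s (bernoulliField p) := by
    rw [ProbabilityTheory.iIndepSet_iff_meas_biInter hsm]
    intro K
    rw [hK]
    exact Finset.prod_congr rfl fun j _ => (h1 j).symm
  -- Second Borel–Cantelli lemma: disjoint bonds are independent, each occupied with probability `p
  -- ^ 2 > 0`.
  have h2 := ProbabilityTheory.measure_limsup_eq_one hsm hind (by
    simp only [h1]
    exact ENNReal.tsum_const_eq_top_of_ne_zero (pow_ne_zero _ (by simpa using hp)))
  have h3 : ∀ᵐ ω ∂(bernoulliField p), ω ∈ Filter.limsup s Filter.atTop := by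
    rw [← mem_ae_iff_prob_eq_one (MeasurableSet.measurableSet_limsup hsm)] at h2
    exact h2
  filter_upwards [h3] with ω hω
  rw [Filter.mem_limsup_iff_frequently_mem] at hω
  exact hω.exists

end Bernoulli

/-! ### The kernel of a larger interval coincides with the thinned field. -/

section Independence

variable {Λ : Finset ℤ} {L R a b : ℤ} {ω : NonIso}

open Classical in
/-- Events at distance from the boundary condition are independent of it. -/
theorem IsWindow.gluedSum_cylinder (p : unitInterval)
    (hw : IsWindow (Icc (a - 2) (b + 2)) L R ω) {B : Set Config}
    (hB : MeasurableSet[cylinderEvents (X := fun _ : ℤ => Fin 2) (Icc a b : Finset ℤ)] B) :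
    gluedSum p (Icc (a - 2) (b + 2)) L R ω ω B =
      bernoulliSum p (Icc (a - 1) (b + 1)) (thin ⁻¹' B) *
      ∑ C ∈ (Icc L R \ Icc (a - 1) (b + 1)).powerset with Fits (Icc (a - 2) (b + 2)) L R ω C,
        siteWeight (activity p L R ω) (1 - p) (Icc L R \ Icc (a - 1) (b + 1)) C := by
  set J := Icc (a - 1) (b + 1) with hJ
  have hJI : J ⊆ Icc L R := (Icc_subset_Icc (by omega) (by omega)).trans hw.subset_Icc
  have hJL : ∀ x ∈ J, x ≠ L ∧ x ≠ R := by
    intro x hx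
    rw [hJ, mem_Icc] at hx
    have := hw.subset x (by rw [mem_Icc]; omega)
    omega
  have hd : Disjoint J (Icc L R \ J) := disjoint_sdiff
  have hu : Icc L R = J ∪ (Icc L R \ J) := (union_sdiff_of_subset hJI).symm
  have hmem : ∀ A ⊆ J, ∀ C ⊆ Icc L R \ J, ∀ x ∈ J, (x ∈ A ∪ C ↔ x ∈ A) := by
    intro A _ C hC x hx
    rw [mem_union]
    exact or_iff_left fun h => (mem_sdiff.1 (hC h)).2 hx
  have hmem' : ∀ A ⊆ J, ∀ C ⊆ Icc L R \ J, ∀ x ∉ J, (x ∈ A ∪ C ↔ x ∈ C) := by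
    intro A hA C _ x hx
    rw [mem_union]
    exact or_iff_right fun h => hx (hA h)
  have hfit : ∀ A ⊆ J, ∀ C ⊆ Icc L R \ J,
      (Fits (Icc (a - 2) (b + 2)) L R ω (A ∪ C) ↔ Fits (Icc (a - 2) (b + 2)) L R ω C) := by
    intro A hA C hC
    refine forall₃_congr fun x _ hx => ?_
    -- A site outside `[a - 2, b + 2]` has no neighbour in `J = [a - 1, b + 1]`, so the constraint
    -- does not see `A`.
    have h1 : x ∉ J ∧ x - 1 ∉ J ∧ x + 1 ∉ J := by
      simp only [hJ, mem_Icc] at hx ⊢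
      omega
    rw [mem_nonIsolated, mem_nonIsolated, hmem' A hA C hC _ h1.1, hmem' A hA C hC _ h1.2.1,
      hmem' A hA C hC _ h1.2.2]
  have hglue : ∀ A ⊆ J, ∀ C ⊆ Icc L R \ J,
      (glue L R ω (A ∪ C) ∈ B ↔ ofOccupied A ∈ thin ⁻¹' B) := by
    intro A hA C hC
    refine mem_congr_of_cylinderEvents hB fun x hx => ?_
    rw [mem_coe, mem_Icc] at hx
    -- The image at a site of `[a, b]` reads sites of `J` only, so the event does not see `C`.
    have h1 : x ∈ J ∧ x - 1 ∈ J ∧ x + 1 ∈ J := by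
      simp only [hJ, mem_Icc]
      omega
    refine eq_of_eq_one_iff ?_
    rw [glue_eq_one_of_mem (hJI h1.1), thin_ofOccupied, mem_nonIsolated, mem_nonIsolated,
      hmem A hA C hC _ h1.1, hmem A hA C hC _ h1.2.1, hmem A hA C hC _ h1.2.2]
  rw [gluedSum, bernoulliSum, Finset.sum_filter, Finset.sum_filter]
  conv_lhs => rw [hu]
  rw [sum_powerset_union hd, Finset.sum_mul_sum]
  refine Finset.sum_congr rfl fun A hA => Finset.sum_congr rfl fun C hC => ?_
  rw [mem_powerset] at hA hC
  rw [if_congr (hfit A hA C hC) rfl rfl]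
  split_ifs
  · rw [siteWeight_union hd hA hC, siteWeight_congr hA fun x hx =>
      activity_of_ne (hJL x hx).1 (hJL x hx).2]
    have h2 : B.indicator (1 : Config → ℝ) (glue L R ω (A ∪ C)) =
        (thin ⁻¹' B).indicator 1 (ofOccupied A) := by
      by_cases h : glue L R ω (A ∪ C) ∈ B
      · rw [Set.indicator_of_mem h, Set.indicator_of_mem ((hglue A hA C hC).1 h)]
        rfl
      · rw [Set.indicator_of_notMem h,
          Set.indicator_of_notMem fun H => h ((hglue A hA C hC).2 H)]
    rw [h2]
    ring
  · rw [mul_zero]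

/-- The sum over the sites outside `[a - 1, b + 1]` is the same for the event and for the whole
space. It cancels in the quotient, and with it every trace of `ω`. -/
theorem thinnedSpec_Icc {p : ℝ} (hp : p ∈ Set.Ioo (0 : ℝ) 1) {A : Set NonIso}
    (hA : MeasurableSet[eventsIn (Icc a b : Finset ℤ)] A) (ω : NonIso) :
    thinnedSpec p (Icc (a - 2) (b + 2)) ω A = thinnedField ⟨p, hp.1.le, hp.2.le⟩ A := by
  obtain ⟨B, hB, rfl⟩ := hA
  obtain ⟨L, R, hw⟩ := exists_isWindow (Icc (a - 2) (b + 2)) ω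
  have h1 := hw.gluedSum_cylinder ⟨p, hp.1.le, hp.2.le⟩ hB
  have h2 := hw.gluedSum_cylinder ⟨p, hp.1.le, hp.2.le⟩
    (@MeasurableSet.univ _ (cylinderEvents (X := fun _ : ℤ => Fin 2) (Icc a b : Finset ℤ)))
  have h3 := hw.gluedSum_univ_pos hp
  rw [Set.preimage_univ, bernoulliSum_univ, one_mul] at h2
  rw [← h2] at h1
  rw [hw.thinnedSpec_preimage hp, thinnedField_eq_bernoulliSum _ hB]
  dsimp only at h1
  rw [h1, mul_div_cancel_right₀ _ h3.ne']

theorem exists_thinnedSpec_eq {p : ℝ} (hp : p ∈ Set.Ioo (0 : ℝ) 1) (J : Finset ℤ) :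
    ∃ Δ : Finset ℤ, J ⊆ Δ ∧ ∀ A, MeasurableSet[eventsIn (J : Set ℤ)] A → ∀ ω,
      thinnedSpec p Δ ω A = thinnedField ⟨p, hp.1.le, hp.2.le⟩ A := by
  obtain ⟨a, ha⟩ := J.bddBelow
  obtain ⟨b, hb⟩ := J.bddAbove
  have hJ : J ⊆ Icc a b := fun x hx => mem_Icc.2 ⟨ha hx, hb hx⟩
  exact ⟨Icc (a - 2) (b + 2), hJ.trans (Icc_subset_Icc (by omega) (by omega)),
    fun A hA ω => thinnedSpec_Icc hp (eventsIn_mono (coe_subset.2 hJ) A hA) ω⟩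

/-- Both integrals depend only on the restrictions of the measures to the smaller σ-algebra. -/
theorem lintegral_eq_of_eventsIn {J : Set ℤ} {μ ν : Measure NonIso}
    (h : ∀ A, MeasurableSet[eventsIn J] A → μ A = ν A) {f : NonIso → ℝ≥0∞}
    (hf : Measurable[eventsIn J] f) : ∫⁻ ω, f ω ∂μ = ∫⁻ ω, f ω ∂ν := by
  rw [← lintegral_trim (eventsIn_le J) hf, ← lintegral_trim (eventsIn_le J) hf]
  congr 1
  refine @Measure.ext _ (eventsIn J) _ _ fun A hA => ?_
  rw [trim_measurableSet_eq _ hA, trim_measurableSet_eq _ hA, h A hA]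

/-- Probability measures on `NonIso` are determined by the cylinder events. -/
theorem ext_of_cylinderEvents {μ ν : Measure NonIso} [IsProbabilityMeasure μ]
    [IsProbabilityMeasure ν]
    (h : ∀ (J : Finset ℤ) (A : Set NonIso), MeasurableSet[eventsIn (J : Set ℤ)] A → μ A = ν A) :
    μ = ν := by
  refine ext_of_generate_finite {A | IsCylinderEvent A} (le_antisymm ?_ ?_) ?_ ?_ (by simp)
  · change MeasurableSpace.comap _ _ ≤ _
    rw [← measurable_iff_comap_le, @measurable_pi_iff]
    intro x s hs
    exact MeasurableSpace.measurableSet_generateFrom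
      ⟨{x}, measurable_apply_eventsIn (by simp : x ∈ (({x} : Finset ℤ) : Set ℤ)) hs⟩
  · refine MeasurableSpace.generateFrom_le ?_
    rintro A ⟨J, hA⟩
    exact eventsIn_le _ A hA
  · rintro A ⟨J, hA⟩ A' ⟨J', hA'⟩ -
    refine ⟨J ∪ J', MeasurableSet.inter ?_ ?_⟩
    · exact eventsIn_mono (coe_subset.2 subset_union_left) A hA
    · exact eventsIn_mono (coe_subset.2 subset_union_right) A' hA'
  · rintro A ⟨J, hA⟩
    exact h J A hA

end Independence

/-! ### Occupied bonds screen off the boundary condition. -/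

section Bonds

variable {p : ℝ} {Λ : Finset ℤ} {k : ℕ} {ω η : NonIso}

/-- There are occupied bonds in `[-k, k]` on both sides of `Λ`. -/
def bondsWithin (Λ : Finset ℤ) (k : ℕ) : Set NonIso :=
  {ω | ∃ L R : ℤ, -(k : ℤ) ≤ L ∧ R ≤ k ∧ L < R ∧ (∀ x ∈ Λ, L + 2 ≤ x ∧ x + 2 ≤ R) ∧
    (ω.1 L = 1 ∧ ω.1 (L + 1) = 1) ∧ ω.1 R = 1 ∧ ω.1 (R - 1) = 1}

theorem monotone_bondsWithin (Λ : Finset ℤ) : Monotone (bondsWithin Λ) := by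
  rintro k l hkl ω ⟨L, R, h1, h2, h⟩
  exact ⟨L, R, by omega, by omega, h⟩

theorem mem_bondsWithin_of_congr (h : ∀ x ∈ Icc (-(k : ℤ)) k, ω.1 x = η.1 x)
    (hω : ω ∈ bondsWithin Λ k) : η ∈ bondsWithin Λ k := by
  obtain ⟨L, R, h1, h2, h3, h4, h5, h6⟩ := hω
  refine ⟨L, R, h1, h2, h3, h4, ?_, ?_⟩
  · rwa [← h L (by rw [mem_Icc]; omega), ← h (L + 1) (by rw [mem_Icc]; omega)]
  · rwa [← h R (by rw [mem_Icc]; omega), ← h (R - 1) (by rw [mem_Icc]; omega)]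

theorem measurableSet_bondsWithin (Λ : Finset ℤ) (k : ℕ) : MeasurableSet (bondsWithin Λ k) := by
  have : Measurable[eventsIn (Icc (-(k : ℤ)) k : Finset ℤ)] (· ∈ bondsWithin Λ k) :=
    measurable_eventsIn_of_congr fun ω η h => propext
      ⟨mem_bondsWithin_of_congr h, mem_bondsWithin_of_congr fun x hx => (h x hx).symm⟩
  have e : bondsWithin Λ k = (· ∈ bondsWithin Λ k) ⁻¹' {True} := by
    ext
    simp
  rw [e]
  exact eventsIn_le _ _ (this (measurableSet_singleton True))

theorem ae_mem_bondsWithin (p : unitInterval) (hp : 0 < (p : ℝ)) (Λ : Finset ℤ) :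
    ∀ᵐ ω ∂(thinnedField p), ω ∈ ⋃ k, bondsWithin Λ k := by
  refine (ae_map_iff (p := fun ω => ω ∈ ⋃ k, bondsWithin Λ k) measurable_toNonIso.aemeasurable
    (MeasurableSet.iUnion fun k => measurableSet_bondsWithin Λ k)).2 ?_
  obtain ⟨b, hb⟩ := Λ.bddBelow
  obtain ⟨c, hc⟩ := Λ.bddAbove
  -- Step 2 makes the bonds disjoint; cutting off at 0 ensures `L < R` even for empty `Λ`.
  filter_upwards [ae_exists_bond p hp (u := fun j => min (b - 2) 0 - 2 * j) (fun i j h => by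
      constructor <;> omega),
    ae_exists_bond p hp (u := fun j => max (c + 1) 0 + 2 * j) (fun i j h => by
      constructor <;> omega)] with ω ⟨i, h1, h2⟩ ⟨j, h3, h4⟩
  set L : ℤ := min (b - 2) 0 - 2 * i with hL
  set R : ℤ := max (c + 1) 0 + 2 * j + 1 with hR
  refine Set.mem_iUnion.2 ⟨L.natAbs + R.natAbs, L, R, by omega, by omega, by omega,
    fun x hx => ?_, ⟨?_, ?_⟩, ?_, ?_⟩
  · have := hb hx
    have := hc hx
    omega
  · exact thin_eq_one.2 ⟨h1, Or.inr h2⟩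
  · exact thin_eq_one.2 ⟨h2, Or.inl (by rwa [add_sub_cancel_right])⟩
  · exact thin_eq_one.2 ⟨h4, Or.inl (by rwa [hR, add_sub_cancel_right])⟩
  · rw [hR, add_sub_cancel_right]
    exact thin_eq_one.2 ⟨h3, Or.inr h4⟩

/-- Between occupied bonds the kernels depend on the boundary condition only locally. -/
theorem thinnedSpec_congr_of_bondsWithin (hp : p ∈ Set.Ioo (0 : ℝ) 1) {J : Finset ℤ}
    {A : Set NonIso} (hA : MeasurableSet[eventsIn (J : Set ℤ)] A)
    (h : ∀ x ∈ Icc (-(k : ℤ)) k ∪ J, ω.1 x = η.1 x) (hω : ω ∈ bondsWithin Λ k) :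
    thinnedSpec p Λ ω A = thinnedSpec p Λ η A := by
  obtain ⟨B, hB, rfl⟩ := hA
  obtain ⟨L, R, h1, h2, h3, h4, h5, h6⟩ := hω
  have hk : ∀ x, L ≤ x → x ≤ R → ω.1 x = η.1 x := fun x hx hx' =>
    h x (mem_union_left _ (by rw [mem_Icc]; omega))
  have hw : IsWindow Λ L R ω := ⟨h3, h4, Or.inl h5, Or.inl h6⟩
  have hw' : IsWindow Λ L R η := by
    refine ⟨h3, h4, Or.inl ?_, Or.inl ?_⟩
    · rwa [← hk L (by omega) (by omega), ← hk (L + 1) (by omega) (by omega)]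
    · rwa [← hk R (by omega) (by omega), ← hk (R - 1) (by omega) (by omega)]
  have key : ∀ B, MeasurableSet[cylinderEvents (X := fun _ : ℤ => Fin 2) (J : Set ℤ)] B →
      gluedSum p Λ L R ω ω B = gluedSum p Λ L R η η B := by
    intro B hB
    rw [gluedSum_congr_left (ω₁ := η) (hw.notMem_of_le (by omega)) (hw.notMem_of_ge (by omega))
      h3.le fun x hx _ => hk x (mem_Icc.1 hx).1 (mem_Icc.1 hx).2]
    refine gluedSum_congr_right fun A => mem_congr_of_cylinderEvents hB fun x hx => ?_
    by_cases hxI : x ∈ Icc L R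
    · simp only [glue, if_pos hxI]
    · rw [glue_of_notMem hxI, glue_of_notMem hxI, h x (mem_union_right _ hx)]
  rw [hw.thinnedSpec_preimage hp, hw'.thinnedSpec_preimage hp, key B hB, key _ MeasurableSet.univ]

end Bonds

/-! ### Existence and uniqueness of the Gibbs measure. -/

section Gibbs

variable {p : ℝ} {Λ : Finset ℤ}

/-- Truncation to `bondsWithin Λ k` loses mass, whence only an inequality, but makes the integrand
local. The field can then be replaced by a kernel `γ_Δ`, and consistency bounds the integral.
Monotone convergence removes the truncation. -/
theorem lintegral_thinnedSpec_le (hp : p ∈ Set.Ioo (0 : ℝ) 1) (Λ : Finset ℤ) {J : Finset ℤ}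
    {A : Set NonIso} (hA : MeasurableSet[eventsIn (J : Set ℤ)] A) :
    ∫⁻ ω, thinnedSpec p Λ ω A ∂(thinnedField ⟨p, hp.1.le, hp.2.le⟩) ≤
      thinnedField ⟨p, hp.1.le, hp.2.le⟩ A := by
  have hA' := eventsIn_le _ A hA
  let f : ℕ → NonIso → ℝ≥0∞ := fun k => (bondsWithin Λ k).indicator fun ω => thinnedSpec p Λ ω A
  have hγ : Measurable fun ω => thinnedSpec p Λ ω A :=
    (measurable_thinnedSpec hp Λ hA').mono (eventsIn_le _) le_rfl
  have hf : ∀ k, Measurable (f k) := fun k => hγ.indicator (measurableSet_bondsWithin Λ k)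
  have hfl : ∀ k : ℕ, Measurable[eventsIn ((Icc (-(k : ℤ)) k ∪ J : Finset ℤ) : Set ℤ)] (f k) := by
    intro k
    refine measurable_eventsIn_of_congr fun ω η h => ?_
    have h' : ∀ x ∈ Icc (-(k : ℤ)) k, ω.1 x = η.1 x := fun x hx => h x (mem_union_left _ hx)
    by_cases hω : ω ∈ bondsWithin Λ k
    · simp only [f]
      rw [Set.indicator_of_mem hω, Set.indicator_of_mem (mem_bondsWithin_of_congr h' hω)]
      exact thinnedSpec_congr_of_bondsWithin hp hA h hω
    · simp only [f]
      rw [Set.indicator_of_notMem hω, Set.indicator_of_notMem fun H =>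
        hω (mem_bondsWithin_of_congr (fun x hx => (h' x hx).symm) H)]
  have hle : ∀ k, ∫⁻ ω, f k ω ∂(thinnedField ⟨p, hp.1.le, hp.2.le⟩) ≤
      thinnedField ⟨p, hp.1.le, hp.2.le⟩ A := by
    intro k
    obtain ⟨Δ, hΔ, h⟩ := exists_thinnedSpec_eq hp (Icc (-(k : ℤ)) k ∪ J ∪ Λ)
    have hsub : ∀ {K : Finset ℤ}, K ⊆ Icc (-(k : ℤ)) k ∪ J ∪ Λ → ∀ A,
        MeasurableSet[eventsIn (K : Set ℤ)] A →
        MeasurableSet[eventsIn ((Icc (-(k : ℤ)) k ∪ J ∪ Λ : Finset ℤ) : Set ℤ)] A :=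
      fun hK => eventsIn_mono (coe_subset.2 hK)
    have hJ : J ⊆ Icc (-(k : ℤ)) k ∪ J ∪ Λ := subset_union_right.trans subset_union_left
    let ω₀ : NonIso := toNonIso 0
    calc ∫⁻ ω, f k ω ∂(thinnedField ⟨p, hp.1.le, hp.2.le⟩)
        = ∫⁻ ω, f k ω ∂(thinnedSpec p Δ ω₀) :=
          lintegral_eq_of_eventsIn
            (fun A hA => (h A (hsub subset_union_left A hA) ω₀).symm) (hfl k)
      _ ≤ ∫⁻ ω, thinnedSpec p Λ ω A ∂(thinnedSpec p Δ ω₀) :=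
          lintegral_mono fun ω => Set.indicator_le_self _ _ ω
      _ = thinnedSpec p Δ ω₀ A := thinnedSpec_consistent hp (subset_union_right.trans hΔ) A ω₀
      _ = thinnedField ⟨p, hp.1.le, hp.2.le⟩ A := h A (hsub hJ A hA) ω₀
  have hmono : Monotone f := fun k l hkl ω =>
    Set.indicator_le_indicator_of_subset (monotone_bondsWithin Λ hkl) (fun _ => bot_le) ω
  calc ∫⁻ ω, thinnedSpec p Λ ω A ∂(thinnedField ⟨p, hp.1.le, hp.2.le⟩)
      ≤ ∫⁻ ω, ⨆ k, f k ω ∂(thinnedField ⟨p, hp.1.le, hp.2.le⟩) := by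
        refine lintegral_mono_ae ?_
        filter_upwards [ae_mem_bondsWithin ⟨p, hp.1.le, hp.2.le⟩ hp.1 Λ] with ω hω
        obtain ⟨k, hk⟩ := Set.mem_iUnion.1 hω
        refine le_iSup_of_le k ?_
        simp only [f]
        rw [Set.indicator_of_mem hk]
    _ = ⨆ k, ∫⁻ ω, f k ω ∂(thinnedField ⟨p, hp.1.le, hp.2.le⟩) := lintegral_iSup hf hmono
    _ ≤ thinnedField ⟨p, hp.1.le, hp.2.le⟩ A := iSup_le hle

/-- The thinned Bernoulli field is invariant under the kernels. -/
theorem lintegral_thinnedSpec_thinnedField (hp : p ∈ Set.Ioo (0 : ℝ) 1) (Λ : Finset ℤ)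
    {A : Set NonIso} (hA : MeasurableSet A) :
    ∫⁻ ω, thinnedSpec p Λ ω A ∂(thinnedField ⟨p, hp.1.le, hp.2.le⟩) =
      thinnedField ⟨p, hp.1.le, hp.2.le⟩ A := by
  set μ := thinnedField ⟨p, hp.1.le, hp.2.le⟩ with hμ
  have hm : Measurable (thinnedSpec p Λ) := Measure.measurable_of_measurable_coe _ fun s hs =>
    (measurable_thinnedSpec hp Λ hs).mono (eventsIn_le _) le_rfl
  have hb : ∀ s, MeasurableSet s → μ.bind (thinnedSpec p Λ) s = ∫⁻ ω, thinnedSpec p Λ ω s ∂μ :=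
    fun s hs => Measure.bind_apply hs hm.aemeasurable
  have hprob : IsProbabilityMeasure (μ.bind (thinnedSpec p Λ)) := by
    constructor
    rw [hb _ MeasurableSet.univ]
    simp [thinnedSpec_univ hp]
  have hle : ∀ (J : Finset ℤ) (A : Set NonIso), MeasurableSet[eventsIn (J : Set ℤ)] A →
      μ.bind (thinnedSpec p Λ) A ≤ μ A := fun J A hA => by
    rw [hb A (eventsIn_le _ A hA)]
    exact lintegral_thinnedSpec_le hp Λ hA
  have heq : μ.bind (thinnedSpec p Λ) = μ := by
    -- Two probability measures with `≤` on an event and on its complement agree on it.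
    refine ext_of_cylinderEvents fun J A hA => le_antisymm (hle J A hA) ?_
    have h1 := hle J Aᶜ hA.compl
    have hA' := eventsIn_le _ A hA
    have h2 := prob_add_prob_compl (μ := μ) hA'
    have h3 := prob_add_prob_compl (μ := μ.bind (thinnedSpec p Λ)) hA'
    have h4 : μ A + μ Aᶜ ≤ μ.bind (thinnedSpec p Λ) A + μ Aᶜ := by
      rw [h2, ← h3]
      exact add_le_add le_rfl h1
    exact (ENNReal.add_le_add_iff_right (measure_ne_top μ _)).1 h4
  rw [← hb A hA, heq]

/-- For `s` depending on spins off `Λ`, `thinnedSpec_inter` moves `s` inside the kernel; invariance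
for `A ∩ s` is then the identity that characterises conditional expectation. -/
theorem thinnedField_mem_gibbsMeasures (hp : p ∈ Set.Ioo (0 : ℝ) 1) :
    thinnedField ⟨p, hp.1.le, hp.2.le⟩ ∈ gibbsMeasures (thinnedSpec p) := by
  set μ := thinnedField ⟨p, hp.1.le, hp.2.le⟩ with hμ
  refine ⟨inferInstance, fun Λ A hA => ?_⟩
  have hγ : Measurable[eventsIn (Λ : Set ℤ)ᶜ] fun ω => (thinnedSpec p Λ ω).real A :=
    (measurable_thinnedSpec hp Λ hA).ennreal_toReal
  have hP := isProbabilityMeasure_thinnedSpec hp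
  have hint : Integrable (fun ω => (thinnedSpec p Λ ω).real A) μ := by
    refine Integrable.of_bound (hγ.mono (eventsIn_le _) le_rfl).aestronglyMeasurable 1 ?_
    refine Filter.Eventually.of_forall fun ω => ?_
    rw [Real.norm_of_nonneg measureReal_nonneg]
    exact measureReal_le_one
  refine (ae_eq_condExp_of_forall_setIntegral_eq (eventsIn_le _)
    ((integrable_const (1 : ℝ)).indicator hA) (fun s _ _ => hint.integrableOn) ?_
    hγ.stronglyMeasurable.aestronglyMeasurable).symm
  intro s hs _
  have hs' := eventsIn_le _ s hs
  rw [setIntegral_indicator hA, setIntegral_const, smul_eq_mul, mul_one]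
  simp only [measureReal_def]
  rw [integral_toReal ((measurable_thinnedSpec hp Λ hA).mono (eventsIn_le _) le_rfl).aemeasurable
    (Filter.Eventually.of_forall fun ω => measure_lt_top _ _), ← lintegral_indicator hs',
    Set.inter_comm, ← lintegral_thinnedSpec_thinnedField hp Λ (hA.inter hs')]
  congr 1
  exact lintegral_congr fun ω => (thinnedSpec_inter hp Λ A hs ω).symm

/-- For a cylinder event and a suitable `Δ`, the conditional probability is almost surely the
constant `μ'_p(A)`; integrating it gives the claim. -/
theorem eq_thinnedField_of_mem_gibbsMeasures (hp : p ∈ Set.Ioo (0 : ℝ) 1) {μ : Measure NonIso}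
    (hμ : μ ∈ gibbsMeasures (thinnedSpec p)) : μ = thinnedField ⟨p, hp.1.le, hp.2.le⟩ := by
  obtain ⟨hμ1, hμ2⟩ := hμ
  refine ext_of_cylinderEvents fun J A hA => ?_
  obtain ⟨Δ, -, h⟩ := exists_thinnedSpec_eq hp J
  have hA' := eventsIn_le _ A hA
  have h1 := integral_congr_ae (hμ2 Δ A hA')
  rw [integral_condExp (eventsIn_le _), integral_indicator_const _ hA', smul_eq_mul, mul_one] at h1
  simp only [measureReal_def, h A hA, integral_const, measure_univ, ENNReal.toReal_one,
    one_smul] at h1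
  exact (ENNReal.toReal_eq_toReal_iff' (measure_ne_top _ _) (measure_ne_top _ _)).1 h1

end Gibbs

end ThinnedBernoulli

theorem mainTheorem3 (p : ℝ) (hp : p ∈ Set.Ioo (0 : ℝ) 1) :
    ThinnedBernoulli.IsSpecification (ThinnedBernoulli.thinnedSpec p) ∧
    ThinnedBernoulli.gibbsMeasures (ThinnedBernoulli.thinnedSpec p) =
      {ThinnedBernoulli.thinnedField ⟨p, hp.1.le, hp.2.le⟩} ∧
    ∀ A : Set ThinnedBernoulli.NonIso, ThinnedBernoulli.IsCylinderEvent A →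
      ∃ Λ : Finset ℤ, ∀ ζ η : ThinnedBernoulli.NonIso,
        ((2 : ℝ) ^ 16)⁻¹ * p ^ 8 * (ThinnedBernoulli.thinnedSpec p Λ η).real A ≤
          (ThinnedBernoulli.thinnedSpec p Λ ζ).real A := by
  refine ⟨ThinnedBernoulli.isSpecification_thinnedSpec hp, ?_, ?_⟩
  · refine Set.eq_singleton_iff_unique_mem.2
      ⟨ThinnedBernoulli.thinnedField_mem_gibbsMeasures hp, fun μ hμ =>
        ThinnedBernoulli.eq_thinnedField_of_mem_gibbsMeasures hp hμ⟩
  · rintro A ⟨J, hA⟩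
    -- For this `Λ` the kernel gives `A` the same mass under every boundary condition, so any
    -- constant at most 1 serves.
    obtain ⟨Λ, -, h⟩ := ThinnedBernoulli.exists_thinnedSpec_eq hp J
    refine ⟨Λ, fun ζ η => ?_⟩
    rw [MeasureTheory.measureReal_def, MeasureTheory.measureReal_def, h A hA, h A hA]
    refine mul_le_of_le_one_left ENNReal.toReal_nonneg ?_
    have h1 : p ^ 8 ≤ 1 := pow_le_one₀ hp.1.le hp.2.le
    have h2 : ((2 : ℝ) ^ 16)⁻¹ ≤ 1 := by norm_num
    exact mul_le_one₀ h2 (pow_nonneg hp.1.le 8) h1
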